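/- Let $K$ be a field and let $l,m,n$ be positive integers with $2\le m\le n$, $l\mid n$ and $l\le\min\{m-1,\frac n2\}$. Let $R=K[x_1,\dots,x_n]$ with the standard grading, read the indices of the variables modulo $n$, and put $k=n/l$. Let $$I=I_{m,l}(C_n)=(u_1,\dots,u_k)\subseteq R,\qquad u_i=\prod_{j=1}^{m}x_{(i-1)l+j}\quad(1\le i\le k),$$ be the path ideal of the $n$-cycle $C_n$. Write $m=tl+s$ with integers $t$ and $0\le s<l$, and $k=p(t+1)+d$ with integers $p\ge 0$ and $0\le d\le t$. Let $\beta_{i,j}$ denote the graded Betti numbers of $R/I$, that is, $F_i=\bigoplus_j R(-j)^{\beta_{i,j}}$ is the $i$-th module of the minimal graded free resolution $\cdots\to F_1\to F_0\to R/I\to 0$, and put $$\mathrm{pd}(R/I)=\max\{i\mid \beta_{i,j}\ne 0\text{ for some }j\},\qquad \mathrm{reg}(R/I)=\max\{j-i\mid \beta_{i,j}\neq 0\}.$$ Then $$\mathrm{pd}(R/I)=\begin{cases}2p,&\text{if } d=0,\\ 2p+1,&\text{if } d\ne 0,\end{cases}\qquad \mathrm{reg}(R/I)=\begin{cases}n-2p,&\text{if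 } d=0,\\ n-2p-1,&\text{if } d\neq 0.\end{cases}$$ -/

import Mathlib

open MvPolynomial

/-- The path ideal `I_{m,l}(C_n)` of the `n`-cycle on the variables `x_a`, `a ∈ ℤ/n`.
It is generated by `u_i = ∏_{j = 1}^{m} x_{(i-1)l+j}` for `1 ≤ i ≤ k`, `k = n / gcd(l, n)`.
The index `i - 1` is the `i : Fin k` below, and indices of variables are read modulo `n`. -/
noncomputable def pathIdeal (K : Type*) [Field K] (m l n : ℕ) :
    Ideal (MvPolynomial (ZMod n) K) :=
  Ideal.span (Set.range fun i : Fin (n / Nat.gcd l n) =>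
    ∏ j ∈ Finset.Icc 1 m, X (((i : ℕ) * l + j : ℕ) : ZMod n))

/-- A minimal graded free resolution
`⋯ ⟶ F₂ ⟶ F₁ ⟶ F₀ ⟶ R/I ⟶ 0` of `R/I`, where `R = K[x_a : a ∈ σ]` has the standard grading.
The module `F_i` is free of finite rank with the basis `Pi.single c 1`, `c : Fin (rank i)`, whose
elements have degrees `shift i c`, so that `F_i = ⨁_c R(-shift i c)`. The modules `F_i` may be
zero. No bound on the length is required. -/
structure MinimalGradedFreeResolution {K σ : Type*} [Field K]
    (I : Ideal (MvPolynomial σ K)) where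
  /-- the rank of `F_i` -/
  rank : ℕ → ℕ
  /-- the degrees of the basis elements of `F_i` -/
  shift : (i : ℕ) → Fin (rank i) → ℕ
  /-- the differential `F_{i+1} ⟶ F_i` -/
  d : (i : ℕ) → (Fin (rank (i + 1)) → MvPolynomial σ K) →ₗ[MvPolynomial σ K]
    (Fin (rank i) → MvPolynomial σ K)
  /-- the augmentation `F₀ ⟶ R/I` -/
  aug : (Fin (rank 0) → MvPolynomial σ K) →ₗ[MvPolynomial σ K] (MvPolynomial σ K ⧸ I)
  /-- The differentials preserve degrees: every monomial `x^u` in the `r`-th coordinate of the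
  image of the `c`-th basis element has `deg u + shift i r = shift (i + 1) c`. -/
  d_graded : ∀ (i : ℕ) (c : Fin (rank (i + 1))) (r : Fin (rank i)) (u : σ →₀ ℕ),
    coeff u (d i (Pi.single c 1) r) ≠ 0 → u.degree + shift i r = shift (i + 1) c
  /-- The augmentation preserves degrees. -/
  aug_graded : ∀ c : Fin (rank 0), ∃ f : MvPolynomial σ K,
    f.IsHomogeneous (shift 0 c) ∧ aug (Pi.single c 1) = Ideal.Quotient.mk I f
  aug_surjective : Function.Surjective aug
  exact_zero : Function.Exact (d 0) aug
  exact_succ : ∀ i : ℕ, Function.Exact (d (i + 1)) (d i)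
  /-- Minimality: all matrix entries of the differentials lie in the ideal generated by the
  variables, that is, they have no constant term. -/
  minimal : ∀ (i : ℕ) (c : Fin (rank (i + 1))) (r : Fin (rank i)),
    constantCoeff (d i (Pi.single c 1) r) = 0

/-- The graded Betti number `β_{i,j}`: the number of summands `R(-j)` in `F_i`. -/
def MinimalGradedFreeResolution.betti {K σ : Type*} [Field K] {I : Ideal (MvPolynomial σ K)}
    (F : MinimalGradedFreeResolution I) (i j : ℕ) : ℕ :=
  (Finset.univ.filter fun c : Fin (F.rank i) => F.shift i c = j).card

/-!
Order the generators `u_1, …, u_k` and adjoin them one at a time. Multiplication by `u_r` gives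
`0 ⟶ R/((u_1, …, u_{r-1}) : u_r) ⟶ R/(u_1, …, u_{r-1}) ⟶ R/(u_1, …, u_r) ⟶ 0`,
so a resolution of `R/I` is an iterated mapping cone over resolutions of the colon ideals. Cutting
the cycle at `u_r` turns its colon ideal into an ideal generated by intervals on a line, whose
resolutions are found by the same recursion. With `P = pd(R/I)`, all summands `R(-j)` of the `i`-th
module obtained in this way satisfy `i ≤ P` and `j - i ≤ n - P`, and `R(-n)` occurs for `i = P`.
In this extremal position it cannot cancel when the resolution is made minimal, so it determines
both invariants.
-/

attribute [local instance] MvPolynomial.gradedAlgebra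

section CommRing

variable {K σ : Type*} [CommRing K]

local notation "𝓡" => MvPolynomial σ K

/-- The vector `v` of the graded free module `⨁_c R(-w c)` is homogeneous of degree `j`. -/
def HasDegree {ι : Type*} (w : ι → ℕ) (j : ℕ) (v : ι → 𝓡) : Prop :=
  ∀ c u, coeff u (v c) ≠ 0 → u.degree + w c = j

/-- The linear map `⨁_c R(-w c) ⟶ ⨁_r R(-w' r)` preserves degrees, tested on the basis. -/
def IsGradedMap {ι κ : Type*} [DecidableEq ι] (w : ι → ℕ) (w' : κ → ℕ)
    (φ : (ι → 𝓡) →ₗ[𝓡] (κ → 𝓡)) : Prop :=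
  ∀ c, HasDegree w' (w c) (φ (Pi.single c 1))

/-- The homogeneous component of degree `j` of a vector of `⨁_c R(-w c)`. -/
noncomputable def degreeComponent {ι : Type*} (w : ι → ℕ) (j : ℕ) (v : ι → 𝓡) : ι → 𝓡 :=
  fun c => if w c ≤ j then homogeneousComponent (j - w c) (v c) else 0

section Degrees

variable {ι : Type*} {w : ι → ℕ} {j : ℕ}

theorem coeff_degreeComponent (w : ι → ℕ) (j : ℕ) (v : ι → 𝓡) (c : ι) (u : σ →₀ ℕ) :
    coeff u (degreeComponent w j v c) = if u.degree + w c = j then coeff u (v c) else 0 := by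
  by_cases h : w c ≤ j
  · rw [degreeComponent, if_pos h, coeff_homogeneousComponent]
    exact if_congr (by omega) rfl rfl
  · rw [degreeComponent, if_neg h, if_neg (by omega), coeff_zero]

theorem hasDegree_degreeComponent (w : ι → ℕ) (j : ℕ) (v : ι → 𝓡) :
    HasDegree w j (degreeComponent w j v) := by
  intro c u h
  rw [coeff_degreeComponent] at h
  exact of_not_not fun h' => h (if_neg h')

theorem HasDegree.degreeComponent_eq {v : ι → 𝓡} (h : HasDegree w j v) :
    degreeComponent w j v = v := by
  funext c
  ext u
  rw [coeff_degreeComponent]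
  exact ite_eq_left_iff.2 fun h' => of_not_not fun h0 => h' (h c u (Ne.symm h0))

theorem degreeComponent_zero (j : ℕ) (v : ι → 𝓡) (c : ι) :
    degreeComponent 0 j v c = homogeneousComponent j (v c) :=
  if_pos j.zero_le

theorem HasDegree.isHomogeneous {v : ι → 𝓡} (h : HasDegree 0 j v) (c : ι) :
    (v c).IsHomogeneous j := by
  intro u hu
  rw [← h c u hu, Pi.zero_apply, add_zero, Finsupp.degree_eq_weight_one]
  rfl

theorem HasDegree.shift {v : ι → 𝓡} (h : HasDegree w j v) (e : ℕ) :
    HasDegree (fun c => w c + e) (j + e) v :=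
  fun c u hu => by rw [← h c u hu, add_assoc]

theorem exists_eq_sum_degreeComponent [Finite ι] (w : ι → ℕ) (v : ι → 𝓡) :
    ∃ N, v = ∑ j ∈ Finset.range N, degreeComponent w j v := by
  cases nonempty_fintype ι
  refine ⟨(∑ c, (w c + (v c).totalDegree)) + 1, ?_⟩
  funext c
  ext u
  simp only [Finset.sum_apply, coeff_sum, coeff_degreeComponent, Finset.sum_ite_eq]
  refine (ite_eq_left_iff.2 fun h => of_not_not fun h0 => h ?_).symm
  have hu : u.degree ≤ (v c).totalDegree := le_totalDegree (mem_support_iff.2 (Ne.symm h0))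
  have hc := Finset.single_le_sum (f := fun c => w c + (v c).totalDegree)
    (fun _ _ => Nat.zero_le _) (Finset.mem_univ c)
  rw [Finset.mem_range]
  omega

end Degrees

section LinearMaps

variable {R ι κ M : Type*} [CommSemiring R] [AddCommMonoid M] [Module R M] [DecidableEq ι]

theorem linearMap_ext_single [Finite ι] {φ ψ : (ι → R) →ₗ[R] M}
    (h : ∀ c, φ (Pi.single c 1) = ψ (Pi.single c 1)) : φ = ψ :=
  (Pi.basisFun R ι).ext fun c => by simpa only [Pi.basisFun_apply] using h c

theorem exists_linearMap_forall_single [Finite ι] (P : ι → M → Prop) (h : ∀ c, ∃ x, P c x) :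
    ∃ φ : (ι → R) →ₗ[R] M, ∀ c, P c (φ (Pi.single c 1)) := by
  choose f hf using h
  refine ⟨(Pi.basisFun R ι).constr R f, fun c => ?_⟩
  rw [← Pi.basisFun_apply, Module.Basis.constr_basis]
  exact hf c

theorem linearMap_apply_eq_sum [Fintype ι] (φ : (ι → R) →ₗ[R] M) (v : ι → R) :
    φ v = ∑ c, v c • φ (Pi.single c 1) := by
  conv_lhs => rw [pi_eq_sum_univ' v, map_sum]
  exact Finset.sum_congr rfl fun c _ => map_smul _ _ _

end LinearMaps

section GradedMaps

variable {ι κ τ : Type*} [DecidableEq ι] {w : ι → ℕ} {w' : κ → ℕ} {w'' : τ → ℕ}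

theorem IsGradedMap.shift {φ : (ι → 𝓡) →ₗ[𝓡] (κ → 𝓡)} (h : IsGradedMap w w' φ) (e : ℕ) :
    IsGradedMap (fun c => w c + e) (fun c => w' c + e) φ :=
  fun c => (h c).shift e

theorem IsGradedMap.map_degreeComponent [Finite ι] {φ : (ι → 𝓡) →ₗ[𝓡] (κ → 𝓡)}
    (hφ : IsGradedMap w w' φ) (j : ℕ) (v : ι → 𝓡) :
    φ (degreeComponent w j v) = degreeComponent w' j (φ v) := by
  classical
  cases nonempty_fintype ι
  funext r
  ext u
  rw [coeff_degreeComponent, linearMap_apply_eq_sum φ v, linearMap_apply_eq_sum φ, ← mul_boole]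
  simp only [Finset.sum_apply, Pi.smul_apply, smul_eq_mul, coeff_sum, coeff_mul, Finset.sum_mul]
  refine Finset.sum_congr rfl fun c _ => Finset.sum_congr rfl fun ab hab => ?_
  rw [coeff_degreeComponent, ← mul_boole, mul_right_comm]
  by_cases hb : coeff ab.2 (φ (Pi.single c 1) r) = 0
  · simp only [hb, mul_zero, zero_mul]
  · have hc := hφ c r ab.2 hb
    have hu := congrArg Finsupp.degree (Finset.HasAntidiagonal.mem_antidiagonal.1 hab)
    rw [map_add] at hu
    congr 1
    exact if_congr (by omega) rfl rfl

theorem HasDegree.map [Finite ι] {φ : (ι → 𝓡) →ₗ[𝓡] (κ → 𝓡)} (hφ : IsGradedMap w w' φ)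
    {j : ℕ} {v : ι → 𝓡} (hv : HasDegree w j v) : HasDegree w' j (φ v) := by
  rw [← hv.degreeComponent_eq, hφ.map_degreeComponent]
  exact hasDegree_degreeComponent _ _ _

theorem IsGradedMap.comp [Finite κ] [DecidableEq κ] {φ : (ι → 𝓡) →ₗ[𝓡] (κ → 𝓡)}
    {ψ : (κ → 𝓡) →ₗ[𝓡] (τ → 𝓡)} (hψ : IsGradedMap w' w'' ψ) (hφ : IsGradedMap w w' φ) :
    IsGradedMap w w'' (ψ ∘ₗ φ) :=
  fun c => (hφ c).map hψ

theorem IsGradedMap.exists_lift [Finite ι] [Finite τ] [DecidableEq τ]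
    {φ : (ι → 𝓡) →ₗ[𝓡] (κ → 𝓡)} {ψ : (τ → 𝓡) →ₗ[𝓡] (κ → 𝓡)} (hφ : IsGradedMap w w' φ)
    (hψ : IsGradedMap w'' w' ψ) (h : ∀ c, ψ (Pi.single c 1) ∈ Set.range φ) :
    ∃ χ : (τ → 𝓡) →ₗ[𝓡] (ι → 𝓡), IsGradedMap w'' w χ ∧ φ ∘ₗ χ = ψ := by
  obtain ⟨χ, hχ⟩ := exists_linearMap_forall_single (R := 𝓡)
    (fun c x => HasDegree w (w'' c) x ∧ φ x = ψ (Pi.single c 1)) fun c => by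
      obtain ⟨x, hx⟩ := h c
      refine ⟨degreeComponent w (w'' c) x, hasDegree_degreeComponent _ _ _, ?_⟩
      rw [hφ.map_degreeComponent, hx, (hψ c).degreeComponent_eq]
  exact ⟨χ, fun c => (hχ c).1, linearMap_ext_single fun c => (hχ c).2⟩

theorem constantCoeff_apply_eq_zero [Finite ι] (φ : (ι → 𝓡) →ₗ[𝓡] (κ → 𝓡)) (v : ι → 𝓡) (r : κ)
    (h : ∀ c, constantCoeff (v c) = 0 ∨ constantCoeff (φ (Pi.single c 1) r) = 0) :
    constantCoeff (φ v r) = 0 := by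
  cases nonempty_fintype ι
  rw [linearMap_apply_eq_sum, Finset.sum_apply, map_sum]
  refine Finset.sum_eq_zero fun c _ => ?_
  rw [Pi.smul_apply, smul_eq_mul, map_mul]
  exact (h c).elim (by simp +contextual) (by simp +contextual)

end GradedMaps

theorem homogeneousComponent_mem_of_isHomogeneous {I : Ideal 𝓡}
    (hI : I.IsHomogeneous (homogeneousSubmodule σ K)) {f : 𝓡} (hf : f ∈ I) (j : ℕ) :
    homogeneousComponent j f ∈ I :=
  decomposition.decompose'_apply f j ▸ hI j hf

/-- A graded free resolution of `R/I`, not necessarily minimal, with finite bases `ι i` of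
degrees `w i`. The augmentation to `R/I` is recorded by a lift to `R`, the free module on `Unit`. -/
structure GradedFreeResolution (I : Ideal 𝓡) where
  /-- the basis of the `i`-th module -/
  ι : ℕ → Type
  finite : ∀ i, Finite (ι i)
  decEq : ∀ i, DecidableEq (ι i)
  /-- the degrees of the basis elements -/
  w : ∀ i, ι i → ℕ
  /-- the differentials -/
  d : ∀ i, (ι (i + 1) → 𝓡) →ₗ[𝓡] (ι i → 𝓡)
  /-- the lift of the augmentation -/
  aug : (ι 0 → 𝓡) →ₗ[𝓡] (Unit → 𝓡)
  d_graded : ∀ i, IsGradedMap (w (i + 1)) (w i) (d i)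
  aug_graded : IsGradedMap (w 0) 0 aug
  aug_surjective : ∀ f, ∃ x, aug x () - f ∈ I
  exact_zero : ∀ x, aug x () ∈ I ↔ x ∈ Set.range (d 0)
  exact_succ : ∀ i, Function.Exact (d (i + 1)) (d i)

theorem exists_dependent_sequence {X : ℕ → Type*} (P : ∀ i, X i → Prop)
    (Q : ∀ i, X i → X (i + 1) → Prop) (x₀ : X 0) (h₀ : P 0 x₀)
    (step : ∀ i x, P i x → ∃ y, P (i + 1) y ∧ Q i x y) :
    ∃ s : ∀ i, X i, s 0 = x₀ ∧ (∀ i, P i (s i)) ∧ ∀ i, Q i (s i) (s (i + 1)) := by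
  choose next hP hQ using step
  let s : ∀ i, {x : X i // P i x} := fun i =>
    Nat.rec ⟨x₀, h₀⟩ (fun i x => ⟨next i x.1 x.2, hP i x.1 x.2⟩) i
  exact ⟨fun i => (s i).1, rfl, fun i => (s i).2, fun i => hQ i (s i).1 (s i).2⟩

namespace GradedFreeResolution

attribute [instance] GradedFreeResolution.finite GradedFreeResolution.decEq

/-- The pairs `(i, j)` such that the `i`-th module of the resolution has a summand `R(-j)`. -/
def degrees {I : Ideal 𝓡} (X : GradedFreeResolution I) : Set (ℕ × ℕ) :=
  {q | ∃ c : X.ι q.1, X.w q.1 c = q.2}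

/-- The basis element `c` of the `i`-th module is not part of a trivial direct summand
`0 ⟶ R(-j) ⟶ R(-j) ⟶ 0`: no entry of a differential in its row or column is a unit. -/
def IsMinimalAt {I : Ideal 𝓡} (X : GradedFreeResolution I) : ∀ i, X.ι i → Prop
  | 0, c => ∀ c', constantCoeff (X.d 0 (Pi.single c' 1) c) = 0
  | i + 1, c => (∀ c', constantCoeff (X.d (i + 1) (Pi.single c' 1) c) = 0) ∧
      ∀ r, constantCoeff (X.d i (Pi.single c 1) r) = 0

variable {I I' : Ideal (MvPolynomial σ K)}

theorem d_comp_d (X : GradedFreeResolution I) (i : ℕ) : X.d i ∘ₗ X.d (i + 1) = 0 :=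
  (X.exact_succ i).linearMap_comp_eq_zero

theorem aug_d_mem (X : GradedFreeResolution I) (x : X.ι 1 → 𝓡) : X.aug (X.d 0 x) () ∈ I :=
  (X.exact_zero _).2 ⟨x, rfl⟩

theorem exists_hasDegree_aug_sub_mem (X : GradedFreeResolution I)
    (hI : I.IsHomogeneous (homogeneousSubmodule σ K)) {f : 𝓡} {j : ℕ} (hf : f.IsHomogeneous j) :
    ∃ x, HasDegree (X.w 0) j x ∧ X.aug x () - f ∈ I := by
  obtain ⟨x, hx⟩ := X.aug_surjective f
  refine ⟨degreeComponent (X.w 0) j x, hasDegree_degreeComponent _ _ _, ?_⟩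
  have h := homogeneousComponent_mem_of_isHomogeneous hI hx j
  rwa [map_sub, homogeneousComponent_eq_self hf, ← degreeComponent_zero,
    ← X.aug_graded.map_degreeComponent] at h

theorem exists_augmentation_lift (X : GradedFreeResolution I') (Y : GradedFreeResolution I)
    (hI : I.IsHomogeneous (homogeneousSubmodule σ K)) {a : 𝓡} {e : ℕ} (ha : a.IsHomogeneous e) :
    ∃ f : (X.ι 0 → 𝓡) →ₗ[𝓡] (Y.ι 0 → 𝓡), IsGradedMap (fun c => X.w 0 c + e) (Y.w 0) f ∧
      ∀ x, Y.aug (f x) () - a * X.aug x () ∈ I := by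
  obtain ⟨f, hf⟩ := exists_linearMap_forall_single (R := 𝓡)
    (fun c y => HasDegree (Y.w 0) (X.w 0 c + e) y ∧
      Y.aug y () - a * X.aug (Pi.single c 1) () ∈ I) fun c =>
        Y.exists_hasDegree_aug_sub_mem hI
          (add_comm e _ ▸ ha.mul ((X.aug_graded c).isHomogeneous ()))
  refine ⟨f, fun c => (hf c).1, fun x => ?_⟩
  let π : (Unit → 𝓡) →ₗ[𝓡] 𝓡 ⧸ I := Submodule.mkQ I ∘ₗ LinearMap.proj ()
  have h : π ∘ₗ Y.aug ∘ₗ f = a • (π ∘ₗ X.aug) :=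
    linearMap_ext_single fun c => (Submodule.Quotient.eq I).2 (hf c).2
  exact (Submodule.Quotient.eq I).1 (LinearMap.congr_fun h x)

theorem exists_chainMap (X : GradedFreeResolution I') (Y : GradedFreeResolution I)
    (hI : I.IsHomogeneous (homogeneousSubmodule σ K)) {a : 𝓡} {e : ℕ} (ha : a.IsHomogeneous e)
    (hmul : ∀ f ∈ I', a * f ∈ I) :
    ∃ f : ∀ i, (X.ι i → 𝓡) →ₗ[𝓡] (Y.ι i → 𝓡),
      (∀ i, IsGradedMap (fun c => X.w i c + e) (Y.w i) (f i)) ∧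
      (∀ x, Y.aug (f 0 x) () - a * X.aug x () ∈ I) ∧
      ∀ i, Y.d i ∘ₗ f (i + 1) = f i ∘ₗ X.d i := by
  obtain ⟨f₀, hf₀, haug⟩ := X.exists_augmentation_lift Y hI ha
  obtain ⟨f, rfl, hf, hcomm⟩ := exists_dependent_sequence
    (X := fun i => (X.ι i → 𝓡) →ₗ[𝓡] (Y.ι i → 𝓡))
    (fun i f => IsGradedMap (fun c => X.w i c + e) (Y.w i) f ∧
      ∀ x, f (X.d i x) ∈ Set.range (Y.d i))
    (fun i f g => Y.d i ∘ₗ g = f ∘ₗ X.d i) f₀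
    ⟨hf₀, fun x => (Y.exact_zero _).1 <| by
      simpa only [sub_add_cancel] using I.add_mem (haug (X.d 0 x)) (hmul _ (X.aug_d_mem x))⟩
    fun i f ⟨hf, hrange⟩ => by
      obtain ⟨g, hg, hcomm⟩ := (Y.d_graded i).exists_lift
        (hf.comp ((X.d_graded i).shift e)) fun c => hrange _
      refine ⟨g, ⟨hg, fun x => (Y.exact_succ i _).1 ?_⟩, hcomm⟩
      rw [← LinearMap.comp_apply, hcomm, LinearMap.comp_apply, (X.exact_succ i).apply_apply_eq_zero,
        map_zero]
  exact ⟨f, fun i => (hf i).1, haug, hcomm⟩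

theorem exists_homotopy (X : GradedFreeResolution I') (Y : GradedFreeResolution I)
    (φ : ∀ i, (X.ι i → 𝓡) →ₗ[𝓡] (Y.ι i → 𝓡))
    (hφ : ∀ i, Y.d i ∘ₗ φ (i + 1) = φ i ∘ₗ X.d i) (h0 : ∀ x, Y.aug (φ 0 x) () ∈ I) :
    ∃ h : ∀ i, (X.ι i → 𝓡) →ₗ[𝓡] (Y.ι (i + 1) → 𝓡),
      φ 0 = Y.d 0 ∘ₗ h 0 ∧ ∀ i, φ (i + 1) = Y.d (i + 1) ∘ₗ h (i + 1) + h i ∘ₗ X.d i := by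
  obtain ⟨h₀, hh₀⟩ := exists_linearMap_forall_single (R := 𝓡)
    (fun c y => Y.d 0 y = φ 0 (Pi.single c 1)) fun c => (Y.exact_zero _).1 (h0 _)
  have e₀ : Y.d 0 ∘ₗ h₀ = φ 0 := linearMap_ext_single hh₀
  obtain ⟨h, rfl, -, hstep⟩ := exists_dependent_sequence
    (X := fun i => (X.ι i → 𝓡) →ₗ[𝓡] (Y.ι (i + 1) → 𝓡))
    (fun i h => Y.d i ∘ₗ (φ (i + 1) - h ∘ₗ X.d i) = 0)
    (fun i h h' => Y.d (i + 1) ∘ₗ h' = φ (i + 1) - h ∘ₗ X.d i) h₀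
    (by rw [LinearMap.comp_sub, ← LinearMap.comp_assoc, e₀, hφ, sub_self])
    fun i h hcycle => by
      obtain ⟨h', hh'⟩ := exists_linearMap_forall_single (R := 𝓡)
        (fun c y => Y.d (i + 1) y = (φ (i + 1) - h ∘ₗ X.d i) (Pi.single c 1))
        fun c => (Y.exact_succ i _).1 (LinearMap.congr_fun hcycle _)
      have e : Y.d (i + 1) ∘ₗ h' = φ (i + 1) - h ∘ₗ X.d i := linearMap_ext_single hh'
      refine ⟨h', ?_, e⟩
      rw [LinearMap.comp_sub, ← LinearMap.comp_assoc, e, hφ, LinearMap.sub_comp, sub_sub_cancel,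
        LinearMap.comp_assoc, d_comp_d, LinearMap.comp_zero]
  exact ⟨h, e₀.symm, fun i => by rw [hstep, sub_add_cancel]⟩

theorem IsMinimalAt.constantCoeff_d {X : GradedFreeResolution I} {i : ℕ} {c : X.ι i}
    (hc : X.IsMinimalAt i c) (c' : X.ι (i + 1)) :
    constantCoeff (X.d i (Pi.single c' 1) c) = 0 := by
  cases i with
  | zero => exact hc c'
  | succ i => exact hc.1 c'

theorem IsMinimalAt.constantCoeff_eq_zero_of_null {X : GradedFreeResolution I} {i : ℕ} {c : X.ι i}
    (hc : X.IsMinimalAt i c) {φ : ∀ i, (X.ι i → 𝓡) →ₗ[𝓡] (X.ι i → 𝓡)}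
    (hφ : ∀ i, X.d i ∘ₗ φ (i + 1) = φ i ∘ₗ X.d i) (h0 : ∀ x, X.aug (φ 0 x) () ∈ I) :
    constantCoeff (φ i (Pi.single c 1) c) = 0 := by
  obtain ⟨h, hzero, hsucc⟩ := exists_homotopy X X φ hφ h0
  have hd (x : X.ι (i + 1) → 𝓡) : constantCoeff (X.d i x c) = 0 :=
    constantCoeff_apply_eq_zero _ _ _ fun c' => Or.inr (hc.constantCoeff_d c')
  cases i with
  | zero =>
    rw [hzero]
    exact hd _
  | succ i =>
    rw [hsucc, LinearMap.add_apply, Pi.add_apply, map_add, LinearMap.comp_apply, hd, zero_add]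
    exact constantCoeff_apply_eq_zero (h i) _ _ fun r => Or.inl (hc.2 r)

/-- The composite of comparison maps `X ⟶ Y ⟶ X` is homotopic to the identity, so its diagonal
entry at a minimal basis element is a unit and factors through a summand of `Y` of the same
degree. -/
theorem IsMinimalAt.mem_degrees [Nontrivial K] {X : GradedFreeResolution I} {i : ℕ} {c : X.ι i}
    (hc : X.IsMinimalAt i c) (Y : GradedFreeResolution I)
    (hI : I.IsHomogeneous (homogeneousSubmodule σ K)) : (i, X.w i c) ∈ Y.degrees := by
  have hmul (f : 𝓡) (hf : f ∈ I) : 1 * f ∈ I := by rwa [one_mul]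
  obtain ⟨f, hfg, hfa, hfd⟩ := X.exists_chainMap Y hI (isHomogeneous_one σ K) hmul
  obtain ⟨g, -, hga, hgd⟩ := Y.exists_chainMap X hI (isHomogeneous_one σ K) hmul
  have hunit := hc.constantCoeff_eq_zero_of_null (φ := fun i => LinearMap.id - g i ∘ₗ f i)
    (fun i => by
      rw [LinearMap.comp_sub, ← LinearMap.comp_assoc, hgd, LinearMap.comp_assoc, hfd,
        LinearMap.sub_comp, LinearMap.comp_id, LinearMap.id_comp, LinearMap.comp_assoc])
    (fun x => by
      have h := I.neg_mem (I.add_mem (hfa x) (hga (f 0 x)))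
      rw [one_mul, one_mul, sub_add_sub_comm, add_comm, add_sub_add_right_eq_sub, neg_sub] at h
      rwa [LinearMap.sub_apply, map_sub])
  by_contra hY
  have hgf : constantCoeff (g i (f i (Pi.single c 1)) c) = 0 :=
    constantCoeff_apply_eq_zero _ _ _ fun c' => Or.inl <| by
      by_contra hne
      have hdeg := hfg i c c' 0 hne
      rw [map_zero, zero_add] at hdeg
      exact hY ⟨c', hdeg⟩
  simp [hgf] at hunit

theorem isMinimalAt_of_forall_degrees {X : GradedFreeResolution I} {i : ℕ} {c : X.ι i}
    (h : ∀ q ∈ X.degrees, q.2 = X.w i c → q.1 ≠ i + 1 ∧ q.1 + 1 ≠ i) : X.IsMinimalAt i c := by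
  have hd (i' : ℕ) (c' : X.ι (i' + 1)) (r : X.ι i') (hw : X.w (i' + 1) c' ≠ X.w i' r) :
      constantCoeff (X.d i' (Pi.single c' 1) r) = 0 := by
    by_contra hne
    have hdeg := X.d_graded i' c' r 0 hne
    rw [map_zero, zero_add] at hdeg
    exact hw hdeg.symm
  have hto (c' : X.ι (i + 1)) : constantCoeff (X.d i (Pi.single c' 1) c) = 0 :=
    hd i c' c fun hw => (h (i + 1, _) ⟨c', rfl⟩ hw).1 rfl
  cases i with
  | zero => exact hto
  | succ i => exact ⟨hto, fun r => hd i c r fun hw => (h (i, _) ⟨r, rfl⟩ hw.symm).2 rfl⟩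

end GradedFreeResolution

section MappingCone

section SumMaps

variable {R α β γ δ : Type*} [CommRing R]

/-- The map `(x, y) ↦ A x + F y` on the free module with basis `α ⊕ β`. -/
noncomputable def sumDesc {M : Type*} [AddCommGroup M] [Module R M]
    (A : (α → R) →ₗ[R] M) (F : (β → R) →ₗ[R] M) : (α ⊕ β → R) →ₗ[R] M :=
  A ∘ₗ LinearMap.funLeft R R Sum.inl + F ∘ₗ LinearMap.funLeft R R Sum.inr

/-- The differential `(x, y) ↦ (A x + F y, -B y)` of a mapping cone. -/
noncomputable def coneMap (A : (α → R) →ₗ[R] (γ → R)) (F : (β → R) →ₗ[R] (γ → R))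
    (B : (β → R) →ₗ[R] (δ → R)) : (α ⊕ β → R) →ₗ[R] (γ ⊕ δ → R) :=
  (LinearEquiv.sumArrowLequivProdArrow γ δ R R).symm.toLinearMap ∘ₗ
    (sumDesc A F).prod (-(B ∘ₗ LinearMap.funLeft R R Sum.inr))

theorem sumDesc_elim {M : Type*} [AddCommGroup M] [Module R M]
    (A : (α → R) →ₗ[R] M) (F : (β → R) →ₗ[R] M) (x : α → R) (y : β → R) :
    sumDesc A F (Sum.elim x y) = A x + F y :=
  rfl

theorem coneMap_elim (A : (α → R) →ₗ[R] (γ → R)) (F : (β → R) →ₗ[R] (γ → R))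
    (B : (β → R) →ₗ[R] (δ → R)) (x : α → R) (y : β → R) :
    coneMap A F B (Sum.elim x y) = Sum.elim (A x + F y) (-(B y)) := by
  ext (c | c) <;> rfl

theorem forall_sum_arrow {M : Type*} {P : (α ⊕ β → M) → Prop} :
    (∀ v, P v) ↔ ∀ x y, P (Sum.elim x y) :=
  ⟨fun h _ _ => h _, fun h v => Sum.elim_comp_inl_inr v ▸ h _ _⟩

variable {ε ζ : Type*} {A₁ : (α → R) →ₗ[R] (γ → R)} {A₀ : (γ → R) →ₗ[R] (ε → R)}
  {F₁ : (β → R) →ₗ[R] (γ → R)} {F₀ : (δ → R) →ₗ[R] (ε → R)}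
  {B₁ : (β → R) →ₗ[R] (δ → R)} {B₀ : (δ → R) →ₗ[R] (ζ → R)}

theorem elim_mem_range_coneMap_iff (hA : Function.Exact A₁ A₀) (hF : A₀ ∘ₗ F₁ = F₀ ∘ₗ B₁)
    (x : γ → R) (y : δ → R) :
    Sum.elim x y ∈ Set.range (coneMap A₁ F₁ B₁) ↔ A₀ x + F₀ y = 0 ∧ y ∈ Set.range B₁ := by
  have hF' (v : β → R) : A₀ (F₁ v) = F₀ (B₁ v) := LinearMap.congr_fun hF v
  constructor
  · rintro ⟨v, hv⟩
    rw [← Sum.elim_comp_inl_inr v, coneMap_elim, Sum.elim_eq_iff] at hv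
    obtain ⟨rfl, rfl⟩ := hv
    rw [map_add, hA.apply_apply_eq_zero, hF', map_neg, zero_add, add_neg_cancel]
    exact ⟨rfl, -(v ∘ Sum.inr), map_neg _ _⟩
  · rintro ⟨h, y', rfl⟩
    obtain ⟨x', hx'⟩ := (hA (x + F₁ y')).1 (by rw [map_add, hF', h])
    refine ⟨Sum.elim x' (-y'), ?_⟩
    rw [coneMap_elim, hx', map_neg, map_neg, neg_neg, add_neg_cancel_right]

theorem exact_coneMap_sumDesc (hA : Function.Exact A₁ A₀) (hF : A₀ ∘ₗ F₁ = F₀ ∘ₗ B₁)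
    (hB : ∀ x y, A₀ x + F₀ y = 0 → y ∈ Set.range B₁) :
    Function.Exact (coneMap A₁ F₁ B₁) (sumDesc A₀ F₀) := by
  refine forall_sum_arrow.2 fun x y => ?_
  rw [elim_mem_range_coneMap_iff hA hF, sumDesc_elim]
  exact ⟨fun h => ⟨h, hB x y h⟩, And.left⟩

theorem exact_coneMap_coneMap (hA : Function.Exact A₁ A₀) (hB : Function.Exact B₁ B₀)
    (hF : A₀ ∘ₗ F₁ = F₀ ∘ₗ B₁) :
    Function.Exact (coneMap A₁ F₁ B₁) (coneMap A₀ F₀ B₀) := by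
  refine forall_sum_arrow.2 fun x y => ?_
  rw [elim_mem_range_coneMap_iff hA hF, coneMap_elim, ← hB y, ← Sum.elim_zero_zero,
    Sum.elim_eq_iff, neg_eq_zero]

end SumMaps

section GradedCone

variable {α β γ δ : Type*} [DecidableEq α] [DecidableEq β] {w : α → ℕ} {w' : β → ℕ}
  {w'' : γ → ℕ} {w''' : δ → ℕ}

theorem isGradedMap_sumDesc {A : (α → 𝓡) →ₗ[𝓡] (γ → 𝓡)} {F : (β → 𝓡) →ₗ[𝓡] (γ → 𝓡)}
    (hA : IsGradedMap w w'' A) (hF : IsGradedMap w' w'' F) :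
    IsGradedMap (Sum.elim w w') w'' (sumDesc A F) := by
  rintro (c | c)
  · rw [← Sum.elim_single_zero, sumDesc_elim, map_zero, add_zero]
    exact hA c
  · rw [← Sum.elim_zero_single, sumDesc_elim, map_zero, zero_add]
    exact hF c

theorem hasDegree_elim {x : γ → 𝓡} {y : δ → 𝓡} {j : ℕ} (hx : HasDegree w'' j x)
    (hy : HasDegree w''' j y) : HasDegree (Sum.elim w'' w''') j (Sum.elim x y) :=
  Sum.rec hx hy

theorem isGradedMap_coneMap {A : (α → 𝓡) →ₗ[𝓡] (γ → 𝓡)} {F : (β → 𝓡) →ₗ[𝓡] (γ → 𝓡)}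
    {B : (β → 𝓡) →ₗ[𝓡] (δ → 𝓡)} (hA : IsGradedMap w w'' A) (hF : IsGradedMap w' w'' F)
    (hB : IsGradedMap w' w''' B) :
    IsGradedMap (Sum.elim w w') (Sum.elim w'' w''') (coneMap A F B) := by
  rintro (c | c)
  · rw [← Sum.elim_single_zero, coneMap_elim, map_zero, map_zero, add_zero, neg_zero]
    exact hasDegree_elim (hA c) fun r u hu => (hu rfl).elim
  · rw [← Sum.elim_zero_single, coneMap_elim, map_zero, zero_add]
    refine hasDegree_elim (hF c) fun r u hu => hB c r u ?_
    simpa only [Pi.neg_apply, coeff_neg, neg_ne_zero] using hu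

end GradedCone

namespace GradedFreeResolution

variable {I J : Ideal (MvPolynomial σ K)}

theorem aug_mem_sup_iff (X : GradedFreeResolution I) (Y : GradedFreeResolution J) {a : 𝓡}
    (hJ : ∀ f, f ∈ J ↔ a * f ∈ I) {f₀ : (Y.ι 0 → 𝓡) →ₗ[𝓡] (X.ι 0 → 𝓡)}
    (hf : ∀ y, X.aug (f₀ y) () - a * Y.aug y () ∈ I) (x : X.ι 0 → 𝓡) :
    X.aug x () ∈ I ⊔ Ideal.span {a} ↔ x ∈ Set.range (sumDesc (X.d 0) f₀) := by
  constructor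
  · intro h
    obtain ⟨g, b, hb, hgb⟩ := Ideal.mem_span_singleton_sup.1 (sup_comm I _ ▸ h)
    obtain ⟨y, hy⟩ := Y.aug_surjective g
    have hx : X.aug (x - f₀ y) () ∈ I := by
      convert I.sub_mem hb (I.add_mem (hf y) ((hJ _).1 hy)) using 1
      rw [map_sub, Pi.sub_apply, ← hgb]
      ring
    obtain ⟨z, hz⟩ := (X.exact_zero _).1 hx
    exact ⟨Sum.elim z y, by rw [sumDesc_elim, hz, sub_add_cancel]⟩
  · rintro ⟨v, rfl⟩
    have hf₀ (y : Y.ι 0 → 𝓡) : X.aug (f₀ y) () ∈ I ⊔ Ideal.span {a} := by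
      rw [← sub_add_cancel (X.aug (f₀ y) ()) (a * Y.aug y ())]
      exact Ideal.add_mem _ (Ideal.mem_sup_left (hf y))
        (Ideal.mem_sup_right (Ideal.mul_mem_right _ _ (Ideal.mem_span_singleton_self a)))
    rw [← Sum.elim_comp_inl_inr v, sumDesc_elim, map_add]
    exact Ideal.add_mem _ (Ideal.mem_sup_left (X.aug_d_mem _)) (hf₀ _)

/-- The mapping cone of a lift `f` of multiplication by `a`, as a map `R/(I : a) ⟶ R/I`. It
resolves `R/(I + (a))`. -/
noncomputable def cone (X : GradedFreeResolution I) (Y : GradedFreeResolution J) (a : 𝓡) (e : ℕ)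
    (hJ : ∀ f, f ∈ J ↔ a * f ∈ I) (f : ∀ i, (Y.ι i → 𝓡) →ₗ[𝓡] (X.ι i → 𝓡))
    (hf : ∀ i, IsGradedMap (fun c => Y.w i c + e) (X.w i) (f i))
    (hfa : ∀ y, X.aug (f 0 y) () - a * Y.aug y () ∈ I)
    (hfd : ∀ i, X.d i ∘ₗ f (i + 1) = f i ∘ₗ Y.d i) :
    GradedFreeResolution (I ⊔ Ideal.span {a}) where
  ι
    | 0 => X.ι 0
    | i + 1 => X.ι (i + 1) ⊕ Y.ι i
  finite
    | 0 => X.finite 0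
    | i + 1 => inferInstanceAs (Finite (X.ι (i + 1) ⊕ Y.ι i))
  decEq
    | 0 => X.decEq 0
    | i + 1 => inferInstanceAs (DecidableEq (X.ι (i + 1) ⊕ Y.ι i))
  w
    | 0 => X.w 0
    | i + 1 => Sum.elim (X.w (i + 1)) (fun c => Y.w i c + e)
  d
    | 0 => sumDesc (X.d 0) (f 0)
    | i + 1 => coneMap (X.d (i + 1)) (f (i + 1)) (Y.d i)
  aug := X.aug
  d_graded
    | 0 => isGradedMap_sumDesc (X.d_graded 0) (hf 0)
    | i + 1 => isGradedMap_coneMap (X.d_graded (i + 1)) (hf (i + 1)) ((Y.d_graded i).shift e)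
  aug_graded := X.aug_graded
  aug_surjective g := (X.aug_surjective g).imp fun _ => Ideal.mem_sup_left
  exact_zero := X.aug_mem_sup_iff Y hJ hfa
  exact_succ
    | 0 => exact_coneMap_sumDesc (X.exact_succ 0) (hfd 0) fun x y h => by
      rw [← Y.exact_zero, hJ]
      have hmem := I.sub_mem (X.aug_d_mem (-x)) (hfa y)
      rwa [map_neg, ← eq_neg_of_add_eq_zero_right h, sub_sub_cancel] at hmem
    | i + 1 => exact_coneMap_coneMap (X.exact_succ (i + 1)) (Y.exact_succ i) (hfd (i + 1))

theorem exists_sup_span_singleton (X : GradedFreeResolution I) (Y : GradedFreeResolution J)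
    (hI : I.IsHomogeneous (homogeneousSubmodule σ K)) {a : 𝓡} {e : ℕ} (ha : a.IsHomogeneous e)
    (hJ : ∀ f, f ∈ J ↔ a * f ∈ I) :
    ∃ Z : GradedFreeResolution (I ⊔ Ideal.span {a}),
      Z.degrees = X.degrees ∪ (fun q => (q.1 + 1, q.2 + e)) '' Y.degrees := by
  obtain ⟨f, hf, hfa, hfd⟩ := Y.exists_chainMap X hI ha fun f => (hJ f).1
  refine ⟨X.cone Y a e hJ f hf hfa hfd, Set.ext ?_⟩
  rintro ⟨i | i, j⟩
  · refine ⟨Or.inl, ?_⟩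
    rintro (h | ⟨q, -, hq⟩)
    · exact h
    · exact absurd (congrArg Prod.fst hq) (Nat.succ_ne_zero _)
  · constructor
    · rintro ⟨c | c, hc⟩
      · exact Or.inl ⟨c, hc⟩
      · exact Or.inr ⟨(i, Y.w i c), ⟨c, rfl⟩, Prod.ext rfl hc⟩
    · rintro (⟨c, hc⟩ | ⟨⟨i', j'⟩, ⟨c, hc⟩, hq⟩)
      · exact ⟨Sum.inl c, hc⟩
      · obtain ⟨hi, hj⟩ := Prod.mk.inj hq
        obtain rfl : i' = i := Nat.succ.inj hi
        exact ⟨Sum.inr c, (congrArg (· + e) hc).trans hj⟩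

theorem exists_top : ∃ X : GradedFreeResolution (⊤ : Ideal 𝓡), X.degrees = ∅ :=
  ⟨{  ι := fun _ => Empty
      finite := fun _ => inferInstance
      decEq := fun _ => inferInstance
      w := fun _ => Empty.elim
      d := fun _ => 0
      aug := 0
      d_graded := fun _ c => c.elim
      aug_graded := fun c => c.elim
      aug_surjective := fun _ => ⟨0, trivial⟩
      exact_zero := fun _ => ⟨fun _ => ⟨0, Subsingleton.elim _ _⟩, fun _ => trivial⟩
      exact_succ := fun _ _ => ⟨fun _ => ⟨0, Subsingleton.elim _ _⟩,
        fun _ => Subsingleton.elim _ _⟩ },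
    Set.eq_empty_of_forall_notMem fun _ ⟨c, _⟩ => c.elim⟩

theorem exists_bot : ∃ X : GradedFreeResolution (⊥ : Ideal 𝓡), X.degrees = {(0, 0)} := by
  refine ⟨{
    ι := fun i => PLift (i = 0)
    finite := fun _ => inferInstance
    decEq := fun _ => inferInstance
    w := fun _ _ => 0
    d := fun _ => 0
    aug := LinearMap.funLeft 𝓡 𝓡 fun _ => ⟨rfl⟩
    d_graded := fun i c => absurd c.down i.succ_ne_zero
    aug_graded := fun c r u hu => ?_
    aug_surjective := fun f => ⟨fun _ => f, (sub_self f).symm ▸ zero_mem _⟩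
    exact_zero := fun x => ?_
    exact_succ := fun i x => ?_ }, Set.ext fun q => ?_⟩
  · classical
    rw [LinearMap.funLeft_apply, Pi.single_eq_same, coeff_one] at hu
    obtain rfl : 0 = u := by_contra fun h => hu (if_neg h)
    simp only [map_zero, Pi.zero_apply, add_zero]
  · rw [Ideal.mem_bot, LinearMap.funLeft_apply]
    exact ⟨fun h => ⟨0, funext fun _ => h.symm⟩, fun ⟨y, hy⟩ => hy ▸ rfl⟩
  · have : IsEmpty (PLift (i + 1 = 0)) := ⟨fun c => i.succ_ne_zero c.down⟩
    exact ⟨fun _ => ⟨0, Subsingleton.elim _ _⟩, fun _ => rfl⟩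
  · exact ⟨fun ⟨c, hc⟩ => Prod.ext c.down hc.symm, fun h => h ▸ ⟨⟨rfl⟩, rfl⟩⟩

end GradedFreeResolution

end MappingCone

section MinimalResolutions

/-- The submodule `N` of the graded free module `⨁_c R(-w c)` is graded. -/
def IsGradedSubmodule {ι : Type*} (w : ι → ℕ) (N : Submodule 𝓡 (ι → 𝓡)) : Prop :=
  ∀ v ∈ N, ∀ j, degreeComponent w j v ∈ N

theorem IsGradedMap.isGradedSubmodule_ker {ι κ : Type*} [Finite ι] [DecidableEq ι] {w : ι → ℕ}
    {w' : κ → ℕ} {φ : (ι → 𝓡) →ₗ[𝓡] (κ → 𝓡)} (hφ : IsGradedMap w w' φ) :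
    IsGradedSubmodule w (LinearMap.ker φ) := by
  intro v hv j
  have hzero : HasDegree w' j (0 : κ → 𝓡) := fun c u hu => absurd (coeff_zero u) hu
  rw [LinearMap.mem_ker, hφ.map_degreeComponent, LinearMap.mem_ker.1 hv, hzero.degreeComponent_eq]

theorem IsGradedSubmodule.span_homogeneous {ι : Type*} [Finite ι] {w : ι → ℕ}
    {N : Submodule 𝓡 (ι → 𝓡)} (hN : IsGradedSubmodule w N) :
    Submodule.span 𝓡 {v | v ∈ N ∧ ∃ j, HasDegree w j v} = N := by
  refine le_antisymm (Submodule.span_le.2 fun v hv => hv.1) fun v hv => ?_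
  obtain ⟨M, hM⟩ := exists_eq_sum_degreeComponent w v
  rw [hM]
  exact Submodule.sum_mem _ fun j _ =>
    Submodule.subset_span ⟨hN v hv j, j, hasDegree_degreeComponent w j v⟩

theorem IsGradedSubmodule.exists_homogeneous_generators {ι : Type*} [Finite ι] {w : ι → ℕ}
    {N : Submodule 𝓡 (ι → 𝓡)} (hN : IsGradedSubmodule w N) (hfg : N.FG) :
    ∃ (r : ℕ) (g : Fin r → ι → 𝓡) (w' : Fin r → ℕ),
      (∀ c, HasDegree w (w' c) (g c)) ∧ Submodule.span 𝓡 (Set.range g) = N := by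
  rw [← hN.span_homogeneous, Submodule.fg_span_iff_fg_span_finset_subset] at hfg
  obtain ⟨T, hT, hspan⟩ := hfg
  choose w' hw' using fun c => (hT (T.equivFin.symm c).2).2
  refine ⟨T.card, Subtype.val ∘ T.equivFin.symm, w', hw', ?_⟩
  rw [EquivLike.range_comp, Subtype.range_coe_subtype, Finset.setOfPred_mem, ← hspan,
    hN.span_homogeneous]

theorem span_range_succAbove {R M : Type*} [Ring R] [AddCommGroup M] [Module R M] {r : ℕ}
    {g : Fin (r + 1) → M} {y : Fin (r + 1) → R} (hy : ∑ c, y c • g c = 0) {c : Fin (r + 1)}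
    (hc : IsUnit (y c)) :
    Submodule.span R (Set.range (g ∘ c.succAbove)) = Submodule.span R (Set.range g) := by
  refine le_antisymm (Submodule.span_mono (Set.range_comp_subset_range _ _))
    (Submodule.span_le.2 ?_)
  rintro _ ⟨c', rfl⟩
  rcases eq_or_ne c' c with rfl | hne
  · rw [Fin.sum_univ_succAbove _ c'] at hy
    refine ((Submodule.span R _).smul_mem_iff_of_isUnit hc).1 ?_
    rw [eq_neg_of_add_eq_zero_left hy]
    exact neg_mem (sum_mem fun i _ => Submodule.smul_mem _ _ (Submodule.subset_span ⟨i, rfl⟩))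
  · obtain ⟨i, rfl⟩ := Fin.exists_succAbove_eq hne
    exact Submodule.subset_span ⟨i, rfl⟩

theorem degreeComponent_self {ι : Type*} (w : ι → ℕ) (v : ι → 𝓡) (c : ι) :
    degreeComponent w (w c) v c = C (constantCoeff (v c)) := by
  rw [degreeComponent, if_pos le_rfl, Nat.sub_self, homogeneousComponent_zero, constantCoeff_eq]

end MinimalResolutions

end CommRing

section Field

variable {K σ : Type*} [Field K]

local notation "𝓡" => MvPolynomial σ K

/-- A cover by the least possible number of homogeneous generators is minimal: a syzygy with a unit
entry would make one of the generators redundant. -/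
theorem IsGradedSubmodule.exists_minimal_cover {ι : Type*} [Finite ι] {w : ι → ℕ}
    {N : Submodule 𝓡 (ι → 𝓡)} (hN : IsGradedSubmodule w N) (hfg : N.FG) :
    ∃ (r : ℕ) (w' : Fin r → ℕ) (φ : (Fin r → 𝓡) →ₗ[𝓡] (ι → 𝓡)),
      IsGradedMap w' w φ ∧ LinearMap.range φ = N ∧
        ∀ x ∈ LinearMap.ker φ, ∀ c, constantCoeff (x c) = 0 := by
  classical
  have hex := hN.exists_homogeneous_generators hfg
  obtain ⟨g, w', hg, hspan⟩ := Nat.find_spec hex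
  have hmin := fun {k : ℕ} => Nat.find_min hex (m := k)
  generalize Nat.find hex = r at g w' hg hspan hmin
  have hφ : IsGradedMap w' w (Fintype.linearCombination 𝓡 g) := fun c => by
    rw [Fintype.linearCombination_apply_single, one_smul]
    exact hg c
  refine ⟨r, w', Fintype.linearCombination 𝓡 g, hφ,
    (Fintype.range_linearCombination 𝓡 g).trans hspan, fun x hx c => ?_⟩
  by_contra hne
  have hker := hφ.isGradedSubmodule_ker x hx (w' c)
  have hunit : IsUnit (degreeComponent w' (w' c) x c) := by
    rw [degreeComponent_self]
    exact (IsUnit.mk0 _ hne).map C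
  cases r with
  | zero => exact c.elim0
  | succ r =>
    exact hmin r.lt_succ_self ⟨g ∘ c.succAbove, w' ∘ c.succAbove, fun _ => hg _,
      (span_range_succAbove hker hunit).trans hspan⟩

/-- A step in the construction of a minimal resolution: the graded free module `R^rank` with basis
degrees `deg`, and the graded submodule `syz` of it that remains to be covered. -/
structure SyzygyStage (K σ : Type*) [Field K] where
  /-- the rank of the free module -/
  rank : ℕ
  /-- the degrees of the basis elements -/
  deg : Fin rank → ℕ
  /-- the submodule to be covered -/
  syz : Submodule (MvPolynomial σ K) (Fin rank → MvPolynomial σ K)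
  graded : IsGradedSubmodule deg syz
  minimal : ∀ v ∈ syz, ∀ c, constantCoeff (v c) = 0

theorem SyzygyStage.exists_cover [Finite σ] (s : SyzygyStage K σ) :
    ∃ (s' : SyzygyStage K σ) (d : (Fin s'.rank → 𝓡) →ₗ[𝓡] (Fin s.rank → 𝓡)),
      IsGradedMap s'.deg s.deg d ∧ LinearMap.range d = s.syz ∧ LinearMap.ker d = s'.syz := by
  obtain ⟨r, w, φ, hφ, hrange, hker⟩ := s.graded.exists_minimal_cover (IsNoetherian.noetherian _)
  exact ⟨⟨r, w, LinearMap.ker φ, hφ.isGradedSubmodule_ker, hker⟩, φ, hφ, hrange, rfl⟩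

/-- The stage `R` with the submodule `I`. -/
noncomputable def SyzygyStage.ofIdeal {I : Ideal 𝓡}
    (hI : I.IsHomogeneous (homogeneousSubmodule σ K))
    (h0 : ∀ f ∈ I, constantCoeff f = 0) : SyzygyStage K σ where
  rank := 1
  deg := 0
  syz := Submodule.comap (LinearMap.proj 0) I
  graded v hv j := by
    rw [Submodule.mem_comap, LinearMap.proj_apply, degreeComponent_zero]
    exact homogeneousComponent_mem_of_isHomogeneous hI hv j
  minimal v hv c := Subsingleton.elim c 0 ▸ h0 _ hv

theorem nonempty_minimalGradedFreeResolution [Finite σ] {I : Ideal 𝓡}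
    (hI : I.IsHomogeneous (homogeneousSubmodule σ K)) (h0 : ∀ f ∈ I, constantCoeff f = 0) :
    Nonempty (MinimalGradedFreeResolution I) := by
  choose next d hd hrange hker using SyzygyStage.exists_cover (K := K) (σ := σ)
  let s : ℕ → SyzygyStage K σ := fun i => Nat.rec (SyzygyStage.ofIdeal hI h0) (fun _ => next) i
  have hexact (i : ℕ) : Function.Exact (d (s (i + 1))) (d (s i)) :=
    LinearMap.exact_iff.2 ((hker _).trans (hrange _).symm)
  have hmem (i : ℕ) (v : Fin (s i).rank → 𝓡) : v ∈ Set.range (d (s i)) ↔ v ∈ (s i).syz := by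
    rw [← hrange]
    rfl
  have haug (v : Fin 1 → 𝓡) : (I.mkQ ∘ₗ LinearMap.proj 0) v = 0 ↔ v ∈ (s 0).syz :=
    Submodule.Quotient.mk_eq_zero I
  have haug_single (c : Fin 1) :
      (I.mkQ ∘ₗ LinearMap.proj 0) (Pi.single c 1 : Fin 1 → 𝓡) = Ideal.Quotient.mk I 1 := by
    rw [Subsingleton.elim c 0, LinearMap.comp_apply, LinearMap.proj_apply, Pi.single_eq_same]
    rfl
  exact ⟨{
    rank := fun i => (s i).rank
    shift := fun i => (s i).deg
    d := fun i => d (s i)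
    aug := I.mkQ ∘ₗ LinearMap.proj (0 : Fin 1)
    d_graded := fun i => hd (s i)
    aug_graded := fun c => ⟨1, isHomogeneous_one _ _, haug_single c⟩
    aug_surjective := I.mkQ_surjective.comp fun f => ⟨fun _ => f, rfl⟩
    exact_zero := fun v => (haug v).trans (hmem 0 v).symm
    exact_succ := hexact
    minimal := fun i c => (s i).minimal _ ((hmem i _).1 ⟨_, rfl⟩) }⟩

namespace MinimalGradedFreeResolution

variable {I : Ideal (MvPolynomial σ K)}

theorem betti_ne_zero_iff (F : MinimalGradedFreeResolution I) (i j : ℕ) :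
    F.betti i j ≠ 0 ↔ ∃ c, F.shift i c = j := by
  rw [betti, Finset.card_ne_zero, Finset.filter_nonempty_iff]
  simp only [Finset.mem_univ, true_and]

theorem exists_augmentation_lift (F : MinimalGradedFreeResolution I) :
    ∃ φ : (Fin (F.rank 0) → 𝓡) →ₗ[𝓡] (Unit → 𝓡), IsGradedMap (F.shift 0) 0 φ ∧
      ∀ x, Ideal.Quotient.mk I (φ x ()) = F.aug x := by
  obtain ⟨φ, hφ⟩ := exists_linearMap_forall_single (R := 𝓡)
    (fun c (y : Unit → 𝓡) => HasDegree 0 (F.shift 0 c) y ∧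
      Ideal.Quotient.mk I (y ()) = F.aug (Pi.single c 1)) fun c => by
        obtain ⟨f, hf, hfc⟩ := F.aug_graded c
        refine ⟨fun _ => f, fun _ u hu => ?_, hfc.symm⟩
        rw [Pi.zero_apply, add_zero, Finsupp.degree_eq_weight_one]
        exact hf hu
  have h : I.mkQ ∘ₗ LinearMap.proj () ∘ₗ φ = F.aug := linearMap_ext_single fun c => (hφ c).2
  exact ⟨φ, fun c => (hφ c).1, LinearMap.congr_fun h⟩

theorem exists_gradedFreeResolution (F : MinimalGradedFreeResolution I) :
    ∃ X : GradedFreeResolution I,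
      X.degrees = {q | F.betti q.1 q.2 ≠ 0} ∧ ∀ i c, X.IsMinimalAt i c := by
  obtain ⟨φ, hφ, haug⟩ := F.exists_augmentation_lift
  refine ⟨{
    ι := fun i => Fin (F.rank i)
    finite := fun _ => inferInstance
    decEq := fun _ => inferInstance
    w := F.shift
    d := F.d
    aug := φ
    d_graded := F.d_graded
    aug_graded := hφ
    aug_surjective := fun f => ?_
    exact_zero := fun x => ?_
    exact_succ := F.exact_succ }, ?_, ?_⟩
  · obtain ⟨x, hx⟩ := F.aug_surjective (Ideal.Quotient.mk I f)
    exact ⟨x, by rw [← Ideal.Quotient.mk_eq_mk_iff_sub_mem, haug, hx]⟩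
  · rw [← Ideal.Quotient.eq_zero_iff_mem, haug]
    exact F.exact_zero x
  · exact Set.ext fun q => (F.betti_ne_zero_iff q.1 q.2).symm
  · rintro (_ | i) c
    · exact fun c' => F.minimal 0 c' c
    · exact ⟨fun c' => F.minimal (i + 1) c' c, F.minimal i c⟩

theorem mem_degrees_of_betti_ne_zero (F : MinimalGradedFreeResolution I)
    (hI : I.IsHomogeneous (homogeneousSubmodule σ K)) (Y : GradedFreeResolution I) {q : ℕ × ℕ}
    (h : F.betti q.1 q.2 ≠ 0) : q ∈ Y.degrees := by
  obtain ⟨X, hX, hmin⟩ := F.exists_gradedFreeResolution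
  obtain ⟨c, hc⟩ : q ∈ X.degrees := hX ▸ h
  have h := (hmin q.1 c).mem_degrees Y hI
  rwa [hc] at h

theorem betti_ne_zero_of_isMinimalAt (F : MinimalGradedFreeResolution I)
    (hI : I.IsHomogeneous (homogeneousSubmodule σ K)) {Y : GradedFreeResolution I} {i : ℕ}
    {c : Y.ι i} (hc : Y.IsMinimalAt i c) : F.betti i (Y.w i c) ≠ 0 := by
  obtain ⟨X, hX, -⟩ := F.exists_gradedFreeResolution
  have h := hc.mem_degrees X hI
  rwa [hX] at h

/-- No summand of a graded free resolution can cancel against one in the extremal position `(p, n)`,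
so it survives in the minimal resolution. -/
theorem isGreatest_of_corner (F : MinimalGradedFreeResolution I)
    (hI : I.IsHomogeneous (homogeneousSubmodule σ K)) {Y : GradedFreeResolution I} {p n : ℕ}
    (hmem : (p, n) ∈ Y.degrees) (hY : ∀ q ∈ Y.degrees, q.1 ≤ p ∧ q.2 + p ≤ n + q.1) :
    IsGreatest {i | ∃ j, F.betti i j ≠ 0} p ∧
      IsGreatest {r : ℤ | ∃ i j, F.betti i j ≠ 0 ∧ r = j - i} (n - p) := by
  obtain ⟨c, hc : Y.w p c = n⟩ := hmem
  have hcorner : Y.IsMinimalAt p c :=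
    GradedFreeResolution.isMinimalAt_of_forall_degrees fun q hq hqn => by
      have := hY q hq
      omega
  have hbetti : F.betti p n ≠ 0 := by
    rw [← hc]
    exact F.betti_ne_zero_of_isMinimalAt hI hcorner
  refine ⟨⟨⟨n, hbetti⟩, ?_⟩, ⟨p, n, hbetti, rfl⟩, ?_⟩
  · rintro i ⟨j, hij⟩
    exact (hY _ (F.mem_degrees_of_betti_ne_zero (q := (i, j)) hI Y hij)).1
  · rintro _ ⟨i, j, hij, rfl⟩
    have := (hY _ (F.mem_degrees_of_betti_ne_zero (q := (i, j)) hI Y hij)).2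
    omega

end MinimalGradedFreeResolution

end Field

section SquarefreeIdeals

variable {K σ : Type*} [CommRing K]

/-- The ideal generated by the squarefree monomials with supports in `A`. -/
noncomputable def squarefreeIdeal (K : Type*) [CommRing K] {σ : Type*} (A : Set (Finset σ)) :
    Ideal (MvPolynomial σ K) :=
  Ideal.span ((fun v : Finset σ => ∏ a ∈ v, X a) '' A)

theorem prod_X_eq_monomial (v : Finset σ) :
    (∏ a ∈ v, X a : MvPolynomial σ K) = monomial (∑ a ∈ v, Finsupp.single a 1) 1 := by
  rw [monomial_sum_one]
  rfl

theorem isHomogeneous_prod_X (v : Finset σ) :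
    (∏ a ∈ v, X a : MvPolynomial σ K).IsHomogeneous v.card := by
  simpa only [Finset.sum_const, smul_eq_mul, mul_one] using
    IsHomogeneous.prod v (fun a => (X a : MvPolynomial σ K)) (fun _ => 1)
      fun a _ => isHomogeneous_X K a

theorem sum_single_apply [DecidableEq σ] (v : Finset σ) (b : σ) :
    (∑ a ∈ v, Finsupp.single a 1 : σ →₀ ℕ) b = if b ∈ v then 1 else 0 := by
  simp only [Finsupp.finsetSum_apply, Finsupp.single_apply, Finset.sum_ite_eq']

theorem sum_single_le_iff (v : Finset σ) (u : σ →₀ ℕ) :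
    (∑ a ∈ v, Finsupp.single a 1 : σ →₀ ℕ) ≤ u ↔ v ⊆ u.support := by
  classical
  refine forall_congr' fun a => ?_
  rw [sum_single_apply, Finsupp.mem_support_iff, ← Nat.one_le_iff_ne_zero]
  split_ifs with ha <;> simp [ha]

theorem mem_squarefreeIdeal_iff (A : Set (Finset σ)) (f : MvPolynomial σ K) :
    f ∈ squarefreeIdeal K A ↔ ∀ u ∈ f.support, ∃ v ∈ A, v ⊆ u.support := by
  have h : (fun v : Finset σ => (∏ a ∈ v, X a : MvPolynomial σ K)) '' A =
      (fun s => monomial s (1 : K)) ''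
        ((fun v : Finset σ => ∑ a ∈ v, Finsupp.single a 1) '' A) := by
    rw [Set.image_image]
    exact Set.image_congr fun v _ => prod_X_eq_monomial v
  simp only [squarefreeIdeal, h, mem_ideal_span_monomial_image, Set.exists_mem_image,
    sum_single_le_iff]

theorem isHomogeneous_squarefreeIdeal (A : Set (Finset σ)) :
    (squarefreeIdeal K A).IsHomogeneous (homogeneousSubmodule σ K) :=
  Ideal.homogeneous_span _ _ <| by
    rintro _ ⟨v, -, rfl⟩
    exact ⟨v.card, isHomogeneous_prod_X v⟩

theorem mem_squarefreeIdeal_sdiff_iff [DecidableEq σ] (A : Set (Finset σ)) (w : Finset σ)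
    (f : MvPolynomial σ K) :
    f ∈ squarefreeIdeal K ((· \ w) '' A) ↔ (∏ a ∈ w, X a) * f ∈ squarefreeIdeal K A := by
  have hsupport (u : σ →₀ ℕ) (a : σ) (ha : a ∉ w) :
      ((∑ a ∈ w, Finsupp.single a 1 : σ →₀ ℕ) + u) a = u a := by
    rw [Finsupp.add_apply, sum_single_apply, if_neg ha, zero_add]
  simp only [prod_X_eq_monomial, mem_squarefreeIdeal_iff, Set.exists_mem_image]
  constructor
  · intro h u hu
    rw [mem_support_iff, coeff_monomial_mul', one_mul] at hu
    obtain ⟨hw, hu⟩ := ite_ne_right_iff.1 hu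
    obtain ⟨v, hv, hvu⟩ := h _ (mem_support_iff.2 hu)
    refine ⟨v, hv, fun a ha => ?_⟩
    by_cases haw : a ∈ w
    · exact (sum_single_le_iff w u).1 hw haw
    · have := Finsupp.mem_support_iff.1 (hvu (Finset.mem_sdiff.2 ⟨ha, haw⟩))
      rwa [← hsupport _ a haw, add_tsub_cancel_of_le hw, ← Finsupp.mem_support_iff] at this
  · intro h u hu
    obtain ⟨v, hv, hvu⟩ := h ((∑ a ∈ w, Finsupp.single a 1) + u) <| by
      rwa [mem_support_iff, coeff_monomial_mul, one_mul, ← mem_support_iff]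
    refine ⟨v, hv, fun a ha => ?_⟩
    obtain ⟨hav, haw⟩ := Finset.mem_sdiff.1 ha
    rw [Finsupp.mem_support_iff, ← hsupport u a haw, ← Finsupp.mem_support_iff]
    exact hvu hav

theorem squarefreeIdeal_le {A B : Set (Finset σ)} (h : ∀ v ∈ A, ∃ v' ∈ B, v' ⊆ v) :
    squarefreeIdeal K A ≤ squarefreeIdeal K B := by
  intro f hf
  rw [mem_squarefreeIdeal_iff] at hf ⊢
  intro u hu
  obtain ⟨v, hv, hvu⟩ := hf u hu
  obtain ⟨v', hv', hv'v⟩ := h v hv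
  exact ⟨v', hv', hv'v.trans hvu⟩

theorem squarefreeIdeal_eq_top {A : Set (Finset σ)} (h : ∅ ∈ A) : squarefreeIdeal K A = ⊤ :=
  (Ideal.eq_top_iff_one _).2 (Ideal.subset_span ⟨∅, h, Finset.prod_empty⟩)

theorem squarefreeIdeal_insert (w : Finset σ) (A : Set (Finset σ)) :
    squarefreeIdeal K (insert w A) = squarefreeIdeal K A ⊔ Ideal.span {∏ a ∈ w, X a} := by
  rw [squarefreeIdeal, Set.image_insert_eq, Ideal.span_insert, sup_comm, squarefreeIdeal]

theorem exists_gradedFreeResolution_insert [DecidableEq σ] {A : Set (Finset σ)} {w : Finset σ}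
    (X : GradedFreeResolution (squarefreeIdeal K A))
    (Y : GradedFreeResolution (squarefreeIdeal K ((· \ w) '' A))) :
    ∃ Z : GradedFreeResolution (squarefreeIdeal K (insert w A)),
      Z.degrees = X.degrees ∪ (fun q => (q.1 + 1, q.2 + w.card)) '' Y.degrees := by
  rw [squarefreeIdeal_insert]
  exact X.exists_sup_span_singleton Y (isHomogeneous_squarefreeIdeal A) (isHomogeneous_prod_X w)
    (mem_squarefreeIdeal_sdiff_iff A w)

theorem exists_gradedFreeResolution_singleton (w : Finset σ) :
    ∃ X : GradedFreeResolution (squarefreeIdeal K {w}), X.degrees = {(0, 0), (1, w.card)} := by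
  classical
  have hempty : squarefreeIdeal K (∅ : Set (Finset σ)) = ⊥ := by
    rw [squarefreeIdeal, Set.image_empty, Ideal.span_empty]
  obtain ⟨X, hX⟩ : ∃ X : GradedFreeResolution (squarefreeIdeal K (∅ : Set (Finset σ))),
      X.degrees = {(0, 0)} := hempty ▸ GradedFreeResolution.exists_bot
  obtain ⟨Y, hY⟩ : ∃ Y : GradedFreeResolution (squarefreeIdeal K ((· \ w) '' ∅)),
      Y.degrees = {(0, 0)} := by
    rw [Set.image_empty]
    exact ⟨X, hX⟩
  obtain ⟨Z, hZ⟩ := exists_gradedFreeResolution_insert X Y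
  rw [← insert_empty_eq w]
  refine ⟨Z, ?_⟩
  rw [hZ, hX, hY, Set.image_singleton, zero_add, zero_add, Set.singleton_union]

end SquarefreeIdeals

section LineBounds

/-- The sum of `⌈a / T⌉` and `⌈(a - 1) / T⌉`, which measures the regularity of an ideal generated by
`a` consecutive intervals. -/
def ceilPair (T a : ℕ) : ℕ := a ⌈/⌉ T + (a - 1) ⌈/⌉ T

theorem ceilDiv_le_ceilDiv {T a b : ℕ} (hT : 0 < T) (h : a ≤ b) : a ⌈/⌉ T ≤ b ⌈/⌉ T :=
  (ceilDiv_le_iff_le_mul hT).2 (h.trans ((ceilDiv_le_iff_le_mul hT).1 le_rfl))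

theorem sub_ceilDiv_add_one {T a : ℕ} (hT : 0 < T) (ha : 0 < a) :
    (a - T) ⌈/⌉ T + 1 = a ⌈/⌉ T := by
  rcases le_total a T with h | h
  · rw [Nat.sub_eq_zero_of_le h, zero_ceilDiv, Nat.ceilDiv_eq_add_pred_div]
    exact (Nat.div_eq_of_lt_le (by omega) (by omega)).symm
  · rw [Nat.ceilDiv_eq_add_pred_div, Nat.ceilDiv_eq_add_pred_div, ← Nat.add_div_right _ hT]
    congr 1
    omega

theorem mul_add_ceilDiv {T : ℕ} (hT : 0 < T) (p d : ℕ) : (p * T + d) ⌈/⌉ T = p + d ⌈/⌉ T := by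
  induction p with
  | zero => rw [zero_mul, zero_add, zero_add]
  | succ p ih =>
    rw [Nat.succ_mul, add_right_comm]
    rcases (p * T + d + T).eq_zero_or_pos with h | h
    · omega
    · rw [← sub_ceilDiv_add_one hT h, Nat.add_sub_cancel, ih, Nat.succ_add]

theorem ceilDiv_eq_one {T d : ℕ} (hd : 0 < d) (hdT : d ≤ T) : d ⌈/⌉ T = 1 := by
  rw [← sub_ceilDiv_add_one (hd.trans_le hdT) hd, Nat.sub_eq_zero_of_le hdT, zero_ceilDiv]

theorem ceilDiv_eq_min_one {T d : ℕ} (hdT : d ≤ T) : d ⌈/⌉ T = min d 1 := by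
  rcases d.eq_zero_or_pos with rfl | hd
  · exact zero_ceilDiv T
  · rw [ceilDiv_eq_one hd hdT, min_eq_right hd]

theorem ceilPair_zero (T : ℕ) : ceilPair T 0 = 0 := by
  rw [ceilPair, Nat.zero_sub, zero_ceilDiv, add_zero]

theorem ceilPair_one {T : ℕ} (hT : 0 < T) : ceilPair T 1 = 1 := by
  rw [ceilPair, ceilDiv_eq_one one_pos hT, Nat.sub_self, zero_ceilDiv, add_zero]

theorem ceilPair_sub_add_two {T a : ℕ} (hT : 0 < T) (ha : 2 ≤ a) :
    ceilPair T (a - T) + 2 = ceilPair T a := by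
  have h := sub_ceilDiv_add_one hT (by omega : 0 < a)
  have h' := sub_ceilDiv_add_one hT (by omega : 0 < a - 1)
  rw [ceilPair, ceilPair, Nat.sub_right_comm]
  omega

theorem ceilPair_mono {T a b : ℕ} (hT : 0 < T) (h : a ≤ b) : ceilPair T a ≤ ceilPair T b :=
  add_le_add (ceilDiv_le_ceilDiv hT h) (ceilDiv_le_ceilDiv hT (Nat.sub_le_sub_right h 1))

theorem ceilPair_succ_le {T a : ℕ} (hT : 2 ≤ T) : ceilPair T (a + 1) ≤ ceilPair T a + 1 := by
  rcases a.eq_zero_or_pos with rfl | ha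
  · rw [ceilPair_zero, ceilPair_one (by omega)]
  have h := sub_ceilDiv_add_one (by omega : 0 < T) (by omega : 0 < a + 1)
  have h' := ceilDiv_le_ceilDiv (by omega : 0 < T) (by omega : a + 1 - T ≤ a - 1)
  rw [ceilPair, ceilPair, Nat.add_sub_cancel]
  omega

theorem ceilPair_add_le {T : ℕ} (hT : 2 ≤ T) (a f : ℕ) : ceilPair T (a + f) ≤ ceilPair T a + f := by
  induction f with
  | zero => rfl
  | succ f ih => exact (ceilPair_succ_le hT).trans (Nat.succ_le_succ ih)

theorem ceilPair_mul_add_add_one {t d : ℕ} (p : ℕ) (hd : d ≤ t) :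
    ceilPair (t + 1) (p * (t + 1) + d + 1) = 2 * p + min d 1 + 1 := by
  have hT : 0 < t + 1 := t.succ_pos
  rw [ceilPair, Nat.add_sub_cancel, add_assoc, mul_add_ceilDiv hT, mul_add_ceilDiv hT,
    ceilDiv_eq_one d.succ_pos (Nat.succ_le_succ hd), ceilDiv_eq_min_one (by omega)]
  omega

/-- Bounds on the positions `S` of a resolution of the ideal generated by the interval `[x, y)` and
the windows that start in `(x, n)`, where `a` and `b` count the possible starting points of windows
in `(x, n]` and `(y, n]` and a window contains at most `T` of them. The position `(i, n - x)` of
maximal degree is attained when the bound for the projective dimension agrees with the one for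
the regularity. -/
structure LineBounds (T n x a b : ℕ) (S : Set (ℕ × ℕ)) : Prop where
  pd_le : ∀ q ∈ S, q.1 ≤ a ⌈/⌉ T + b ⌈/⌉ T
  reg_le : ∀ q ∈ S, q.2 + x + max (ceilPair T a) (ceilPair T b + 1) ≤ n + q.1
  top_mem : b < a → a < b + T →
    a ⌈/⌉ T + b ⌈/⌉ T = max (ceilPair T a) (ceilPair T b + 1) → (a ⌈/⌉ T + b ⌈/⌉ T, n - x) ∈ S

theorem lineBounds_empty (T n x a : ℕ) : LineBounds T n x a a ∅ :=
  ⟨fun _ h => h.elim, fun _ h => h.elim, fun h => absurd h (lt_irrefl a)⟩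

theorem lineBounds_single {T n x y b : ℕ} (hT : 0 < T) (hb : b ≤ 1) (hxy : x < y) (hyn : y ≤ n)
    (hb0 : b = 0 ↔ y = n) : LineBounds T n x 1 b {(0, 0), (1, y - x)} := by
  have hceil : b ⌈/⌉ T = b := by
    interval_cases b
    exacts [zero_ceilDiv T, ceilDiv_eq_one one_pos hT]
  have hpair : ceilPair T b = b := by
    interval_cases b
    exacts [ceilPair_zero T, ceilPair_one hT]
  constructor
  · rw [ceilDiv_eq_one one_pos hT]
    rintro q (rfl | rfl) <;> simp only <;> omega
  · rw [hpair, ceilPair_one hT]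
    rintro q (rfl | rfl) <;> simp only <;> omega
  · intro h _ _
    obtain rfl : b = 0 := by omega
    rw [ceilDiv_eq_one one_pos hT, hceil, hb0.1 rfl]
    exact Or.inr rfl

theorem LineBounds.union {T n x y x' a b : ℕ} {S S' : Set (ℕ × ℕ)} (hT : 2 ≤ T) (ha : 2 ≤ a)
    (hxy : x ≤ y) (hyn : y ≤ n) (hba : b ≤ a) (hab : a - T ≤ b) (hx' : x < x')
    (hx'' : b = a → x + 2 ≤ x') (hS : LineBounds T n x' (a - 1) (a - T) S)
    (hS' : LineBounds T n y b (a - T) S') :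
    LineBounds T n x a b (S ∪ (fun q => (q.1 + 1, q.2 + (y - x))) '' S') := by
  have hT0 : 0 < T := by omega
  have hceil := sub_ceilDiv_add_one hT0 (by omega : 0 < a)
  have hpair := ceilPair_sub_add_two hT0 ha
  have hceil_pred := ceilDiv_le_ceilDiv hT0 (Nat.sub_le a 1)
  have hceil_b := ceilDiv_le_ceilDiv hT0 hab
  refine ⟨?_, ?_, fun h1 h2 h3 => Or.inr ⟨(b ⌈/⌉ T + (a - T) ⌈/⌉ T, n - y), ?_, ?_⟩⟩
  · rintro q (hq | ⟨q, hq, rfl⟩)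
    · have := hS.pd_le q hq
      omega
    · have := hS'.pd_le q hq
      dsimp only
      omega
  · rintro q (hq | ⟨q, hq, rfl⟩)
    · have := hS.reg_le q hq
      rcases hba.eq_or_lt with rfl | hlt
      · have := hx'' rfl
        omega
      · have := ceilPair_mono hT0 (by omega : b ≤ a - 1)
        omega
    · have := hS'.reg_le q hq
      dsimp only
      omega
  · have hb : 0 < b := by
      by_contra hb
      obtain rfl : b = 0 := by omega
      rw [(by omega : a - T = 0), zero_ceilDiv] at hceil
      rw [zero_ceilDiv] at h3
      omega
    exact hS'.top_mem (by omega) (by omega) (by omega)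
  · rw [Prod.mk.injEq]
    omega

end LineBounds

section Intervals

variable {K σ : Type*} [CommRing K] [DecidableEq σ]

/-- The set of the variables with the numbers in `[x, y)` when the variables are numbered by `φ`. -/
def interval (φ : ℕ → σ) (x y : ℕ) : Finset σ := (Finset.Ico x y).image φ

theorem interval_self (φ : ℕ → σ) (x : ℕ) : interval φ x x = ∅ := by
  rw [interval, Finset.Ico_self, Finset.image_empty]

theorem interval_subset {φ : ℕ → σ} {x y x' y' : ℕ} (hx : x' ≤ x) (hy : y ≤ y') :
    interval φ x y ⊆ interval φ x' y' :=
  Finset.image_subset_image (Finset.Ico_subset_Ico hx hy)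

theorem card_interval {φ : ℕ → σ} {n x y : ℕ} (hφ : Set.InjOn φ (Set.Iio n)) (hy : y ≤ n) :
    (interval φ x y).card = y - x := by
  rw [interval, Finset.card_image_of_injOn, Nat.card_Ico]
  exact hφ.mono fun z hz => (Finset.mem_Ico.1 hz).2.trans_le hy

theorem interval_sdiff {φ : ℕ → σ} {n x y z w : ℕ} (hφ : Set.InjOn φ (Set.Iio n)) (hy : y ≤ n)
    (hw : w ≤ n) (hxz : x ≤ z) :
    interval φ z w \ interval φ x y = interval φ (max z y) w := by
  ext b
  simp only [interval, Finset.mem_sdiff, Finset.mem_image, Finset.mem_Ico]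
  constructor
  · rintro ⟨⟨i, hi, rfl⟩, hxy⟩
    exact ⟨i, ⟨max_le hi.1 (not_lt.1 fun h => hxy ⟨i, ⟨hxz.trans hi.1, h⟩, rfl⟩), hi.2⟩, rfl⟩
  · rintro ⟨i, hi, rfl⟩
    refine ⟨⟨i, ⟨by omega, hi.2⟩, rfl⟩, ?_⟩
    rintro ⟨j, hj, hji⟩
    have := hφ (Set.mem_Iio.2 (hj.2.trans_le hy)) (Set.mem_Iio.2 (hi.2.trans_le hw)) hji
    omega

/-- The intervals `[j * l, j * l + m)` with `e ≤ j < k`, cut off at `k * l`. -/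
def lineWindows (φ : ℕ → σ) (l m k e : ℕ) : Set (Finset σ) :=
  (fun j => interval φ (j * l) (min (j * l + m) (k * l))) '' Set.Ico e k

theorem lineWindows_eq_insert (φ : ℕ → σ) (l m : ℕ) {k e : ℕ} (he : e < k) :
    lineWindows φ l m k e =
      insert (interval φ (e * l) (min (e * l + m) (k * l))) (lineWindows φ l m k (e + 1)) := by
  rw [lineWindows, ← Set.insert_Ico_add_one_left_eq_Ico he, Set.image_insert_eq, lineWindows]

/-- If `z < e * l`, the first interval on the right contains the window with the number `e` and is
redundant. Keeping it makes the recursion for lines uniform. -/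
theorem squarefreeIdeal_truncatedWindows (φ : ℕ → σ) {l m k e y z : ℕ} (hl : 0 < l) (he : e < k)
    (hez : e ≤ z / l + 1) (hyz : y ≤ z) (hz : z ≤ max (e * l) y) :
    squarefreeIdeal K
        ((fun j => interval φ (max (j * l) y) (min (j * l + m) (k * l))) '' Set.Ico e k) =
      squarefreeIdeal K
        (insert (interval φ z (min (e * l + m) (k * l))) (lineWindows φ l m k (z / l + 1))) := by
  apply le_antisymm <;> refine squarefreeIdeal_le ?_
  · rintro _ ⟨j, ⟨hej, hjk⟩, rfl⟩
    rcases le_or_gt j (z / l) with hj | hj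
    · have := (Nat.le_div_iff_mul_le hl).1 hj
      have := Nat.mul_le_mul_right l hej
      exact ⟨_, Set.mem_insert _ _, interval_subset (by omega) (by omega)⟩
    · have := (Nat.div_lt_iff_lt_mul hl).1 hj
      exact ⟨_, Set.mem_insert_of_mem _ ⟨j, ⟨hj, hjk⟩, rfl⟩, interval_subset (by omega) le_rfl⟩
  · rintro _ (rfl | ⟨j, ⟨hzj, hjk⟩, rfl⟩)
    · exact ⟨_, ⟨e, ⟨le_rfl, he⟩, rfl⟩, interval_subset hz le_rfl⟩
    · exact ⟨_, ⟨j, ⟨hez.trans hzj, hjk⟩, rfl⟩, interval_subset (le_max_left _ _) le_rfl⟩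

theorem squarefreeIdeal_lineWindows_sdiff {φ : ℕ → σ} {l m k x y : ℕ}
    (hφ : Set.InjOn φ (Set.Iio (k * l))) (hl : 0 < l) (hk : x / l + 1 < k) (hxy : x ≤ y)
    (hy : y ≤ k * l) :
    squarefreeIdeal K ((· \ interval φ x y) '' lineWindows φ l m k (x / l + 1)) =
      squarefreeIdeal K (insert (interval φ y (min ((x / l + 1) * l + m) (k * l)))
        (lineWindows φ l m k (y / l + 1))) := by
  rw [← squarefreeIdeal_truncatedWindows φ hl hk
    (Nat.add_le_add_right (Nat.div_le_div_right hxy) 1) le_rfl (le_max_right _ _), lineWindows,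
    Set.image_image]
  congr 1
  refine Set.image_congr fun j hj => interval_sdiff hφ hy (min_le_right _ _) ?_
  exact ((Nat.div_lt_iff_lt_mul hl).1 hj.1).le

theorem min_mul_add_div {l : ℕ} (hl : 0 < l) (m e k : ℕ) :
    min (e * l + m) (k * l) / l = min (e + m / l) k := by
  rw [Monotone.map_min (f := (· / l)) fun _ _ h => Nat.div_le_div_right h,
    Nat.mul_div_cancel _ hl, mul_comm e, Nat.mul_add_div hl]

theorem exists_line_resolution_insert {φ : ℕ → σ} {l m k x y : ℕ}
    (hφ : Set.InjOn φ (Set.Iio (k * l))) (hl : 0 < l) (hlm : l ≤ m) (hk : x / l + 1 < k)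
    (hxy : x < y) (hy : y ≤ min ((x / l + 1) * l + m) (k * l))
    (hX : ∃ X : GradedFreeResolution (squarefreeIdeal K (lineWindows φ l m k (x / l + 1))),
      LineBounds (m / l + 1) (k * l) ((x / l + 1) * l) (k - (x / l + 1))
        (k - min (x / l + 1 + m / l) k) X.degrees)
    (hY : ∃ Y : GradedFreeResolution (squarefreeIdeal K
        ((· \ interval φ x y) '' lineWindows φ l m k (x / l + 1))),
      LineBounds (m / l + 1) (k * l) y (k - y / l) (k - min (x / l + 1 + m / l) k) Y.degrees) :
    ∃ Z : GradedFreeResolution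
        (squarefreeIdeal K (insert (interval φ x y) (lineWindows φ l m k (x / l + 1)))),
      LineBounds (m / l + 1) (k * l) x (k - x / l) (k - y / l) Z.degrees := by
  obtain ⟨X, hX⟩ := hX
  obtain ⟨Y, hY⟩ := hY
  obtain ⟨Z, hZ⟩ := exists_gradedFreeResolution_insert X Y
  have ht : 0 < m / l := Nat.div_pos hlm hl
  have hyk : y ≤ k * l := hy.trans (min_le_right _ _)
  have hxdiv : x / l ≤ y / l := Nat.div_le_div_right hxy.le
  have hydiv : y / l ≤ min (x / l + 1 + m / l) k := by
    rw [← min_mul_add_div hl]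
    exact Nat.div_le_div_right hy
  have hx' : x < (x / l + 1) * l := (Nat.div_lt_iff_lt_mul hl).1 (Nat.lt_succ_self _)
  refine ⟨Z, ?_⟩
  rw [hZ, card_interval hφ hyk]
  refine LineBounds.union (x' := (x / l + 1) * l) (by omega) (by omega) hxy.le hyk (by omega)
    (by omega) hx' (fun h => ?_) ?_ ?_
  · have hy' : y < (x / l + 1) * l := (Nat.div_lt_iff_lt_mul hl).1 (by omega)
    omega
  · convert hX using 1 <;> omega
  · convert hY using 1
    omega

theorem exists_line_resolution (K : Type*) [CommRing K] {φ : ℕ → σ} {l m k x y : ℕ}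
    (hφ : Set.InjOn φ (Set.Iio (k * l))) (hl : 0 < l) (hlm : l ≤ m) (hxy : x ≤ y)
    (hy : y ≤ min ((x / l + 1) * l + m) (k * l)) :
    ∃ X : GradedFreeResolution
        (squarefreeIdeal K (insert (interval φ x y) (lineWindows φ l m k (x / l + 1)))),
      LineBounds (m / l + 1) (k * l) x (k - x / l) (k - y / l) X.degrees := by
  have hyk : y ≤ k * l := hy.trans (min_le_right _ _)
  rcases hxy.eq_or_lt with rfl | hxy
  · obtain ⟨X, hX⟩ := GradedFreeResolution.exists_top (K := K) (σ := σ)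
    rw [interval_self, squarefreeIdeal_eq_top (Set.mem_insert _ _)]
    refine ⟨X, ?_⟩
    rw [hX]
    exact lineBounds_empty _ _ _ _
  have hxk : x / l < k := (Nat.div_lt_iff_lt_mul hl).2 (hxy.trans_le hyk)
  rcases Nat.lt_or_ge (x / l + 1) k with hk | hk
  · have : x < (x / l + 1) * l := (Nat.div_lt_iff_lt_mul hl).1 (Nat.lt_succ_self _)
    have hmono {i j : ℕ} (h : i ≤ j) : min (i * l + m) (k * l) ≤ min (j * l + m) (k * l) :=
      min_le_min_right _ (Nat.add_le_add_right (Nat.mul_le_mul_right l h) m)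
    have hX := exists_line_resolution K (x := (x / l + 1) * l)
      (y := min ((x / l + 1) * l + m) (k * l)) hφ hl hlm
      (le_min (Nat.le_add_right _ _) (Nat.mul_le_mul_right l hk.le))
      (hmono (by rw [Nat.mul_div_cancel _ hl]; exact Nat.le_succ _))
    have hY := exists_line_resolution K (x := y) hφ hl hlm hy
      (hmono (Nat.add_le_add_right (Nat.div_le_div_right hxy.le) 1))
    rw [Nat.mul_div_cancel _ hl, min_mul_add_div hl, ← lineWindows_eq_insert φ l m hk] at hX
    rw [min_mul_add_div hl, ← squarefreeIdeal_lineWindows_sdiff hφ hl hk hxy.le hyk] at hY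
    exact exists_line_resolution_insert hφ hl hlm hk hxy hy hX hY
  · have hempty : lineWindows φ l m k (x / l + 1) = ∅ := by
      rw [lineWindows, Set.Ico_eq_empty (by omega), Set.image_empty]
    obtain ⟨X, hX⟩ := exists_gradedFreeResolution_singleton (K := K) (interval φ x y)
    rw [hempty, insert_empty_eq]
    refine ⟨X, ?_⟩
    have hyl : x / l ≤ y / l := Nat.div_le_div_right hxy.le
    rw [hX, card_interval hφ hyk, (by omega : k - x / l = 1)]
    refine lineBounds_single (Nat.succ_pos _) (by omega) hxy hyk ?_
    rw [Nat.sub_eq_zero_iff_le, Nat.le_div_iff_mul_le hl]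
    exact hyk.ge_iff_eq
termination_by k * l - x
decreasing_by all_goals omega

end Intervals

section Cycle

variable {K : Type*} [CommRing K]

/-- The vertices of the `n`-cycle, counted from the vertex `c`. -/
def cyclicIndex (n c i : ℕ) : ZMod n := ((c + i : ℕ) : ZMod n)

/-- The support of the `j`-th generator of the path ideal of the `n`-cycle, where `j` counts from
zero. -/
def cycleWindow (l m n j : ℕ) : Finset (ZMod n) := interval (cyclicIndex n (j * l + 1)) 0 m

theorem injOn_cyclicIndex (n c : ℕ) : Set.InjOn (cyclicIndex n c) (Set.Iio n) := by
  intro i hi j hj h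
  have hij : i ≡ j [MOD n] :=
    Nat.ModEq.add_left_cancel' c ((ZMod.natCast_eq_natCast_iff _ _ _).1 h)
  rwa [Nat.ModEq, Nat.mod_eq_of_lt hi, Nat.mod_eq_of_lt hj] at hij

theorem card_cycleWindow {m n : ℕ} (hmn : m ≤ n) (l j : ℕ) : (cycleWindow l m n j).card = m :=
  card_interval (injOn_cyclicIndex n _) hmn

theorem interval_cyclicIndex_add {n c c' z : ℕ} (h : c + z ≡ c' [MOD n]) (m : ℕ) :
    interval (cyclicIndex n c) z (z + m) = interval (cyclicIndex n c') 0 m := by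
  rw [interval, interval, ← add_zero z, add_assoc, zero_add, ← Finset.image_add_left_Ico,
    Finset.image_image]
  refine Finset.image_congr fun i _ => ?_
  rw [Function.comp_apply, cyclicIndex, cyclicIndex, ZMod.natCast_eq_natCast_iff, ← add_assoc]
  exact h.add_right i

theorem interval_cyclicIndex_sdiff {m n : ℕ} (hmn : m ≤ n) (c : ℕ) {z : ℕ} (hz : z ≤ n) :
    interval (cyclicIndex n c) z (z + m) \ interval (cyclicIndex n c) 0 m =
      interval (cyclicIndex n c) (max z m) (min (z + m) n) := by
  rw [← interval_sdiff (injOn_cyclicIndex n c) hmn (min_le_right _ _) z.zero_le]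
  refine subset_antisymm (fun b hb => ?_)
    (Finset.sdiff_subset_sdiff (interval_subset le_rfl (min_le_left _ _)) subset_rfl)
  obtain ⟨hbz, hbm⟩ := Finset.mem_sdiff.1 hb
  obtain ⟨i, hi, rfl⟩ := Finset.mem_image.1 hbz
  obtain ⟨hzi, him⟩ := Finset.mem_Ico.1 hi
  rcases lt_or_ge i n with hin | hin
  · exact Finset.mem_sdiff.2
      ⟨Finset.mem_image_of_mem _ (Finset.mem_Ico.2 ⟨hzi, lt_min him hin⟩), hbm⟩
  · refine absurd ?_ hbm
    rw [← interval_cyclicIndex_add (by simp [Nat.ModEq] : c + n ≡ c [MOD n]) m]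
    exact Finset.mem_image_of_mem _ (Finset.mem_Ico.2 ⟨hin, by omega⟩)

theorem cycleWindow_sdiff {k l m r j : ℕ} (hm : m ≤ k * l) (hr : r ≤ k) (hj : j ≤ r) :
    cycleWindow l m (k * l) j \ cycleWindow l m (k * l) r =
      interval (cyclicIndex (k * l) (r * l + 1)) (max ((k - r + j) * l) m)
        (min ((k - r + j) * l + m) (k * l)) := by
  have h : r * l + 1 + (k - r + j) * l ≡ j * l + 1 [MOD k * l] := by
    have : r * l + 1 + (k - r + j) * l = j * l + 1 + k * l := by
      rw [add_right_comm, ← add_mul, add_right_comm, ← add_mul]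
      congr 2
      omega
    simp [this, Nat.ModEq]
  rw [← interval_cyclicIndex_sdiff hm _ (Nat.mul_le_mul_right l (by omega)), cycleWindow,
    cycleWindow, interval_cyclicIndex_add h]

theorem squarefreeIdeal_cycleWindow_sdiff {k l m r : ℕ} (hl : 0 < l) (hm : m ≤ k * l)
    (hr0 : 0 < r) (hr : r < k) :
    squarefreeIdeal K
        ((· \ cycleWindow l m (k * l) r) '' (cycleWindow l m (k * l) '' Set.Iio r)) =
      squarefreeIdeal K (insert
        (interval (cyclicIndex (k * l) (r * l + 1)) (max ((k - r) * l) m)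
          (min ((k - r) * l + m) (k * l)))
        (lineWindows (cyclicIndex (k * l) (r * l + 1)) l m k (max ((k - r) * l) m / l + 1))) := by
  have hdiv : k - r ≤ max ((k - r) * l) m / l :=
    (Nat.le_div_iff_mul_le hl).2 (le_max_left _ _)
  rw [← squarefreeIdeal_truncatedWindows _ hl (by omega) (by omega) (le_max_right _ _) le_rfl]
  have hIco : Set.Ico (k - r) k = (k - r + ·) '' Set.Ico 0 r := by
    rw [Set.image_const_add_Ico, add_zero, Nat.sub_add_cancel hr.le]
  rw [hIco, Set.image_image, Set.image_image, ← Nat.bot_eq_zero, Set.Ico_bot]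
  congr 1
  exact Set.image_congr fun j hj => cycleWindow_sdiff hm hr.le (le_of_lt hj)

theorem add_sub_div_le_max {l : ℕ} (hl : 0 < l) (m e : ℕ) : m + (e - m / l) ≤ max (e * l) m := by
  rcases le_or_gt e (m / l) with h | h
  · omega
  · obtain ⟨f, rfl⟩ := Nat.exists_eq_add_of_lt h
    have hm : m < (m / l + 1) * l := (Nat.div_lt_iff_lt_mul hl).1 (Nat.lt_succ_self _)
    have hf : f ≤ f * l := Nat.le_mul_of_pos_right f hl
    rw [add_right_comm, add_mul]
    omega

theorem LineBounds.succ_le {t k m n x e P : ℕ} {S : Set (ℕ × ℕ)} (ht : 0 < t) (he : 0 < e)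
    (hk : 0 < k) (hx : m + (e - t) ≤ x) (hP : P + 1 = ceilPair (t + 1) (k + 1))
    (hS : LineBounds (t + 1) n x (k - max e t) (k - min (e + t) k) S) :
    ∀ q ∈ S, q.1 + 1 ≤ P ∧ q.2 + m + P ≤ n + q.1 + 1 := by
  intro q hq
  have hpair := ceilPair_sub_add_two (T := t + 1) t.succ_pos (by omega : 2 ≤ k + 1)
  have hceil_succ := sub_ceilDiv_add_one (T := t + 1) t.succ_pos (by omega : 0 < k + 1)
  have hceil := sub_ceilDiv_add_one (T := t + 1) t.succ_pos hk
  rw [Nat.add_sub_add_right] at hpair hceil_succ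
  constructor
  · have := hS.pd_le q hq
    have := ceilDiv_le_ceilDiv (T := t + 1) t.succ_pos (by omega : k - max e t ≤ k - t)
    have := ceilDiv_le_ceilDiv (T := t + 1) t.succ_pos
      (by omega : k - min (e + t) k ≤ k - (t + 1))
    rw [ceilPair, Nat.add_sub_cancel] at hP
    omega
  · have := hS.reg_le q hq
    have := ceilPair_mono (T := t + 1) t.succ_pos
      (by omega : k - t ≤ k - max e t + (e - t))
    have := ceilPair_add_le (T := t + 1) (by omega) (k - max e t) (e - t)
    omega

theorem LineBounds.pred_mem {t k m n p d P : ℕ} {S : Set (ℕ × ℕ)} (ht : 0 < t)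
    (hkpd : k = (p + 1) * (t + 1) + d) (hd : d ≤ t) (hP : P + 1 = ceilPair (t + 1) (k + 1))
    (hS : LineBounds (t + 1) n m (k - max (max d 1) t) (k - min (max d 1 + t) k) S) :
    (P - 1, n - m) ∈ S := by
  have hT : 0 < t + 1 := t.succ_pos
  have hceil_d : d ⌈/⌉ (t + 1) = min d 1 := ceilDiv_eq_min_one (by omega)
  have hceil_b : (min d 1) ⌈/⌉ (t + 1) = min d 1 := by
    rw [ceilDiv_eq_min_one (by omega), min_assoc, min_self]
  have hceil_succ := ceilDiv_eq_one d.succ_pos (by omega : d + 1 ≤ t + 1)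
  have ha : k - max (max d 1) t = p * (t + 1) + (d + 1) := by
    rw [hkpd, Nat.succ_mul]
    omega
  have hb : k - min (max d 1 + t) k = p * (t + 1) + min d 1 := by
    rw [hkpd, Nat.succ_mul]
    omega
  have hpred := ceilDiv_le_ceilDiv hT (by omega : p * (t + 1) + min d 1 - 1 ≤ p * (t + 1) + 0)
  rw [mul_add_ceilDiv hT, zero_ceilDiv] at hpred
  rw [ha, hb] at hS
  rw [hkpd, ceilPair, Nat.add_sub_cancel, add_assoc, mul_add_ceilDiv hT, mul_add_ceilDiv hT,
    hceil_d, hceil_succ] at hP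
  have htop := hS.top_mem (by omega) (by omega)
  simp only [ceilPair, ← add_assoc, Nat.add_sub_cancel] at htop
  rw [add_assoc, mul_add_ceilDiv hT, mul_add_ceilDiv hT, mul_add_ceilDiv hT, hceil_d, hceil_b,
    hceil_succ] at htop
  convert htop (by omega) using 2
  omega

theorem exists_cycle_colon_resolution (K : Type*) [CommRing K] {k l m P r : ℕ} (hl : 0 < l)
    (hlm : l ≤ m) (hm : m ≤ k * l) (hP : P + 1 = ceilPair (m / l + 1) (k + 1)) (hr0 : 0 < r)
    (hr : r < k) :
    ∃ Y : GradedFreeResolution (squarefreeIdeal K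
        ((· \ cycleWindow l m (k * l) r) '' (cycleWindow l m (k * l) '' Set.Iio r))),
      (∀ q ∈ Y.degrees, q.1 + 1 ≤ P ∧ q.2 + m + P ≤ k * l + q.1 + 1) ∧
      (r = k - max (k % (m / l + 1)) 1 → (P - 1, k * l - m) ∈ Y.degrees) := by
  have ht : 0 < m / l := Nat.div_pos hlm hl
  have hxdiv : max ((k - r) * l) m / l = max (k - r) (m / l) := by
    rw [Monotone.map_max (f := (· / l)) fun _ _ h => Nat.div_le_div_right h,
      Nat.mul_div_cancel _ hl]
  have hmul : (k - r) * l ≤ k * l := Nat.mul_le_mul_right l (k.sub_le r)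
  have hmul' : (k - r) * l ≤ (max (k - r) (m / l) + 1) * l :=
    Nat.mul_le_mul_right l (by omega)
  have hY := exists_line_resolution K (k := k) (x := max ((k - r) * l) m)
    (y := min ((k - r) * l + m) (k * l)) (injOn_cyclicIndex (k * l) (r * l + 1)) hl hlm
    (by omega) (by rw [hxdiv]; omega)
  rw [← squarefreeIdeal_cycleWindow_sdiff hl hm hr0 hr, hxdiv, min_mul_add_div hl] at hY
  obtain ⟨Y, hY⟩ := hY
  refine ⟨Y, hY.succ_le ht (by omega) (by omega) (add_sub_div_le_max hl m (k - r)) hP,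
    fun hr' => ?_⟩
  have hmod : k % (m / l + 1) ≤ m / l := Nat.lt_succ_iff.1 (Nat.mod_lt k (Nat.succ_pos _))
  have hdiv := Nat.div_add_mod' k (m / l + 1)
  have he : k - r = max (k % (m / l + 1)) 1 := by omega
  obtain ⟨p, hp⟩ := Nat.exists_eq_add_one_of_ne_zero fun h : k / (m / l + 1) = 0 => by
    rw [h] at hdiv
    omega
  have hem : (k - r) * l ≤ m := (Nat.le_div_iff_mul_le hl).1 (by omega)
  rw [max_eq_right hem, he] at hY
  exact hY.pred_mem ht (hp ▸ hdiv.symm) hmod hP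

theorem exists_cycle_resolution_one (K : Type*) [CommRing K] {k l m P : ℕ} (hl : 0 < l)
    (hlm : l ≤ m) (hm : m ≤ k * l) (hP : P + 1 = ceilPair (m / l + 1) (k + 1)) (hk : 1 ≤ k) :
    ∃ X : GradedFreeResolution (squarefreeIdeal K (cycleWindow l m (k * l) '' Set.Iio 1)),
      (∀ q ∈ X.degrees, q.1 ≤ P ∧ q.2 + P ≤ k * l + q.1) ∧
      (k - max (k % (m / l + 1)) 1 < 1 → (P, k * l) ∈ X.degrees) := by
  have ht : 0 < m / l := Nat.div_pos hlm hl
  have hpair := ceilPair_sub_add_two (T := m / l + 1) (Nat.succ_pos _) (by omega : 2 ≤ k + 1)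
  have hpair_le := ceilPair_add_le (T := m / l + 1) (by omega) 0 (k - m / l)
  have hmax := add_sub_div_le_max hl m k
  rw [Nat.add_sub_add_right] at hpair
  rw [zero_add, ceilPair_zero] at hpair_le
  have hIio : cycleWindow l m (k * l) '' Set.Iio 1 = {cycleWindow l m (k * l) 0} := by
    rw [← Set.image_singleton, (by ext; simp : Set.Iio 1 = {0})]
  obtain ⟨X, hX⟩ := exists_gradedFreeResolution_singleton (K := K) (cycleWindow l m (k * l) 0)
  rw [hIio]
  refine ⟨X, ?_⟩
  rw [hX, card_cycleWindow hm]
  refine ⟨?_, fun h => Or.inr ?_⟩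
  · rintro q (rfl | rfl) <;> simp only <;> omega
  · have hmod : k % (m / l + 1) ≤ m / l := Nat.lt_succ_iff.1 (Nat.mod_lt k (Nat.succ_pos _))
    have hkl : k * l ≤ m := (Nat.le_div_iff_mul_le hl).1 (by omega)
    rw [(by omega : k - m / l = 0), ceilPair_zero] at hpair
    rw [Set.mem_singleton_iff, Prod.mk.injEq]
    omega

theorem exists_cycle_resolution (K : Type*) [CommRing K] {k l m P r : ℕ} (hl : 0 < l)
    (hlm : l ≤ m) (hm : m ≤ k * l) (hP : P + 1 = ceilPair (m / l + 1) (k + 1)) (hr : 1 ≤ r)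
    (hrk : r ≤ k) :
    ∃ X : GradedFreeResolution (squarefreeIdeal K (cycleWindow l m (k * l) '' Set.Iio r)),
      (∀ q ∈ X.degrees, q.1 ≤ P ∧ q.2 + P ≤ k * l + q.1) ∧
      (k - max (k % (m / l + 1)) 1 < r → (P, k * l) ∈ X.degrees) := by
  induction r, hr using Nat.le_induction with
  | base => exact exists_cycle_resolution_one K hl hlm hm hP hrk
  | succ r hr ih =>
    obtain ⟨X, hX, hX_top⟩ := ih (by omega)
    obtain ⟨Y, hY, hY_top⟩ := exists_cycle_colon_resolution K hl hlm hm hP hr hrk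
    obtain ⟨Z, hZ⟩ := exists_gradedFreeResolution_insert X Y
    rw [← Order.succ_eq_add_one, Order.Iio_succ_eq_insert, Set.image_insert_eq]
    refine ⟨Z, ?_⟩
    rw [hZ, card_cycleWindow hm]
    refine ⟨?_, fun hlt => ?_⟩
    · rintro _ (hq | ⟨q, hq, rfl⟩)
      · exact hX _ hq
      · have := hY q hq
        dsimp only
        omega
    · rcases Nat.lt_succ_iff_lt_or_eq.1 hlt with h | h
      · exact Or.inl (hX_top h)
      · have hmem := hY_top h.symm
        refine Or.inr ⟨_, hmem, ?_⟩
        have := hY _ hmem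
        rw [Prod.mk.injEq]
        omega

end Cycle

section PathIdeal

theorem pathIdeal_eq_squarefreeIdeal (K : Type*) [Field K] {l m n : ℕ} (hln : l ∣ n)
    (hmn : m ≤ n) :
    pathIdeal K m l n = squarefreeIdeal K (cycleWindow l m n '' Set.Iio (n / l)) := by
  have hprod (j : ℕ) : (∏ a ∈ cycleWindow l m n j, X a : MvPolynomial (ZMod n) K) =
      ∏ i ∈ Finset.Icc 1 m, X ((j * l + i : ℕ) : ZMod n) := by
    have hinj : Set.InjOn (cyclicIndex n (j * l + 1)) (Finset.Ico 0 m : Finset ℕ) :=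
      (injOn_cyclicIndex n _).mono fun i hi => (Finset.mem_Ico.1 hi).2.trans_le hmn
    rw [cycleWindow, interval, Finset.prod_image hinj, ← Finset.Ico_add_one_right_eq_Icc,
      Finset.prod_Ico_eq_prod_range _ 1, Nat.add_sub_cancel, ← Finset.range_eq_Ico]
    exact Finset.prod_congr rfl fun i _ => by rw [cyclicIndex, add_assoc]
  rw [pathIdeal, squarefreeIdeal, Nat.gcd_eq_left hln, Set.image_image]
  simp only [hprod]
  congr 1
  ext f
  constructor
  · rintro ⟨i, rfl⟩
    exact ⟨i, i.2, rfl⟩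
  · rintro ⟨j, hj, rfl⟩
    exact ⟨⟨j, hj⟩, rfl⟩

theorem isHomogeneous_pathIdeal (K : Type*) [Field K] (m l n : ℕ) :
    (pathIdeal K m l n).IsHomogeneous (homogeneousSubmodule (ZMod n) K) :=
  Ideal.homogeneous_span _ _ <| by
    rintro _ ⟨i, rfl⟩
    exact ⟨_, IsHomogeneous.prod _ _ (fun _ => 1) fun _ _ => isHomogeneous_X K _⟩

theorem constantCoeff_eq_zero_of_mem_pathIdeal {K : Type*} [Field K] {m l n : ℕ} (hm : 1 ≤ m)
    {f : MvPolynomial (ZMod n) K} (hf : f ∈ pathIdeal K m l n) : constantCoeff f = 0 := by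
  suffices h : pathIdeal K m l n ≤ RingHom.ker constantCoeff from h hf
  refine Ideal.span_le.2 ?_
  rintro _ ⟨i, rfl⟩
  rw [SetLike.mem_coe, RingHom.mem_ker, map_prod]
  exact Finset.prod_eq_zero (Finset.mem_Icc.2 ⟨le_rfl, hm⟩) (constantCoeff_X K _)

theorem exists_pathIdeal_resolution (K : Type*) [Field K] {l m n p d : ℕ} (hl : 0 < l)
    (hlm : l ≤ m) (hmn : m ≤ n) (hln : l ∣ n) (hpd : n / l = p * (m / l + 1) + d)
    (hd : d ≤ m / l) :
    ∃ Y : GradedFreeResolution (pathIdeal K m l n), (2 * p + min d 1, n) ∈ Y.degrees ∧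
      ∀ q ∈ Y.degrees, q.1 ≤ 2 * p + min d 1 ∧ q.2 + (2 * p + min d 1) ≤ n + q.1 := by
  rw [pathIdeal_eq_squarefreeIdeal K hln hmn]
  have hk : 0 < n / l := Nat.div_pos (hlm.trans hmn) hl
  have hmod : n / l % (m / l + 1) = d := by
    rw [hpd, Nat.mul_add_mod_of_lt (Nat.lt_succ_of_le hd)]
  have hn : n / l * l = n := Nat.div_mul_cancel hln
  have hcycle := exists_cycle_resolution K (k := n / l) hl hlm (hmn.trans_eq hn.symm)
    (by rw [hpd, ceilPair_mul_add_add_one p hd]) hk le_rfl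
  rw [hn] at hcycle
  obtain ⟨Y, hY, htop⟩ := hcycle
  exact ⟨Y, htop (by omega), hY⟩

end PathIdeal

theorem corollary5p4 {K : Type*} [Field K] (m l n t s k p d : ℕ)
    (hm : 2 ≤ m) (hmn : m ≤ n) (hl : 1 ≤ l) (hln : l ∣ n) (hlm : l ≤ m - 1) (hl2 : 2 * l ≤ n)
    (hmts : m = t * l + s) (hs : s < l) (hk : k = n / l)
    (hkpd : k = p * (t + 1) + d) (hd : d ≤ t) :
    Nonempty (MinimalGradedFreeResolution (pathIdeal K m l n)) ∧
    ∀ F : MinimalGradedFreeResolution (pathIdeal K m l n),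
      IsGreatest {i : ℕ | ∃ j : ℕ, F.betti i j ≠ 0} (if d = 0 then 2 * p else 2 * p + 1) ∧
      IsGreatest {r : ℤ | ∃ i j : ℕ, F.betti i j ≠ 0 ∧ r = (j : ℤ) - (i : ℤ)}
        (if d = 0 then (n : ℤ) - 2 * (p : ℤ) else (n : ℤ) - 2 * (p : ℤ) - 1) := by
  have ht : m / l = t := by
    rw [hmts, mul_comm, Nat.mul_add_div hl, Nat.div_eq_of_lt hs, add_zero]
  obtain ⟨Y, hcorner, hY⟩ := exists_pathIdeal_resolution K hl (hlm.trans (m.sub_le 1)) hmn hln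
    (by rw [← hk, ht, hkpd]) (hd.trans_eq ht.symm)
  have hpd : (if d = 0 then 2 * p else 2 * p + 1) = 2 * p + min d 1 := by
    split_ifs <;> omega
  have hreg : (if d = 0 then (n : ℤ) - 2 * p else (n : ℤ) - 2 * p - 1) =
      n - (2 * p + min d 1 : ℕ) := by
    split_ifs <;> omega
  have hI := isHomogeneous_pathIdeal K m l n
  have : NeZero n := ⟨by omega⟩
  rw [hpd, hreg]
  exact ⟨nonempty_minimalGradedFreeResolution hI
      fun _ => constantCoeff_eq_zero_of_mem_pathIdeal (one_le_two.trans hm),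
    fun F => F.isGreatest_of_corner hI hcorner hY⟩
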